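/- Let $x_{t+1}=Ax_t+Bu_t$ with $A\in\mathbb R^{n\times n}$, $B\in\mathbb R^{n\times m}$, let $Q\succeq 0$, $R\succ 0$, $P\succeq 0$, let $H_i\succeq 0$ for $i$ in a finite index set $\mathcal I$, and suppose that $(A,B)$ is stabilizable and $(A,\sqrt Q)$ is detectable. For a horizon $T$, vectors $c_{i|t}$, $e_t$, scalars $d_{i|t}$, matrices $G_t$ and dual variables $\lambda_{i|t}\ge 0$, $\mu_t\ge 0$ $(0\le t<T)$ put $Q_{\lambda|t}=Q+\sum_i\lambda_{i|t}H_i$ and consider the Lagrangian cost-to-go $$x_T^\top Px_T+\sum_{k=t}^{T-1}\Big(x_k^\top Q_{\lambda|k}x_k+\sum_i\lambda_{i|k}(c_{i|k}^\top x_k+d_{i|k})+\mu_k^\top(G_ku_k+e_k)+u_k^\top Ru_k\Big).$$ Let $F_T=P$, $S_T=0$ and, for $t<T$, with $M_t=B^\top F_{t+1}B+R$ and $K_t=M_t^{-1}B^\top F_{t+1}A$, $$F_t=A^\top F_{t+1}A+Q_{\lambda|t}-A^\top F_{t+1}BM_t^{-1}B^\top F_{t+1}A,$$ $$S_t=\sum_i\lambda_{i|t}c_{i|t}+A^\top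 S_{t+1}-K_t^\top(B^\top S_{t+1}+G_t^\top\mu_t),$$ $$u_t^*(x,\lambda,\mu)=-K_tx+l_t,\qquad l_t=-\tfrac12M_t^{-1}(B^\top S_{t+1}+G_t^\top\mu_t).$$ Then the following hold. (a) $(A,\sqrt{Q+\sum_i\lambda_iH_i})$ is detectable for all $\lambda_i\ge0$. (b) For every $t\le T$ and every state $x_t$, the law $u^*$ minimizes the Lagrangian cost-to-go over all input sequences. (c) The law $u^*$ stabilizes the system: for every $\Lambda\in\mathbb R$ there are $C>0$ and $\alpha\in(0,1)$, depending only on $A,B,Q,R,P,(H_i)$ and $\Lambda$, such that, with $\|\cdot\|$ the maximum norm: (c1) for every horizon $T$, all $c,d,G,e$ and all dual variables with $0\le\lambda_{i|t}\le\Lambda$ and $\mu_t\ge0$ for $0\le t<T$, any two trajectories $x,y$ of the closed loop $x_{k+1}=Ax_k+Bu_k^*(x_k,\lambda,\mu)$ on $[r,T]$ satisfy $$\|x_t-y_t\|\le C\alpha^{t-r}\|x_r-y_r\|\qquad(r\le t\le T);$$ (c2) if moreover $\lambda,\mu,c,G$ do not depend on time, then for each fixed $t$ the gain $K_t$ and the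 offset $l_t$ for horizon $T$ converge as $T\to\infty$ to limits $K_\infty$ and $l_\infty$ that do not depend on $t$; the spectral radius of $A-BK_\infty$ is less than $1$; and the closed loop $x_{t+1}=Ax_t+B(-K_\infty x_t+l_\infty)$ has an equilibrium $\bar x$ such that every solution satisfies $\|x_t-\bar x\|\le C\alpha^t\|x_0-\bar x\|$ for all $t\ge 0$. -/

import Mathlib

open Filter Topology Matrix
open scoped MatrixOrder

noncomputable section

/-- A real square matrix is Schur stable if its spectral radius (the largest modulus of its
complex eigenvalues) is smaller than one. -/
def SchurStable {n : ℕ} (A : Matrix (Fin n) (Fin n) ℝ) : Prop :=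
  spectralRadius ℂ (A.map (fun a : ℝ => (a : ℂ))) < 1

/-- `(A, B)` is stabilizable: some static state feedback makes the closed loop Schur stable. -/
def Stabilizable {n m : ℕ} (A : Matrix (Fin n) (Fin n) ℝ) (B : Matrix (Fin n) (Fin m) ℝ) : Prop :=
  ∃ K : Matrix (Fin m) (Fin n) ℝ, SchurStable (A + B * K)

/-- `(A, C)` is detectable: some output injection makes the error dynamics Schur stable. -/
def Detectable {n p : ℕ} (A : Matrix (Fin n) (Fin n) ℝ) (C : Matrix (Fin p) (Fin n) ℝ) : Prop :=
  ∃ L : Matrix (Fin n) (Fin p) ℝ, SchurStable (A - L * C)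

/-- The system matrices `A, B`, the weights `Q, R, P` of the quadratic cost, and the Hessians
`H i` of the convexified state constraints. -/
structure LQR (n m : ℕ) (ι : Type*) where
  A : Matrix (Fin n) (Fin n) ℝ
  B : Matrix (Fin n) (Fin m) ℝ
  Q : Matrix (Fin n) (Fin n) ℝ
  R : Matrix (Fin m) (Fin m) ℝ
  P : Matrix (Fin n) (Fin n) ℝ
  H : ι → Matrix (Fin n) (Fin n) ℝ

/-- The standing assumptions on the system and the weights. -/
structure LQR.Standing {n m : ℕ} {ι : Type*} (L : LQR n m ι) : Prop where
  stabilizable : Stabilizable L.A L.B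
  posSemidef_Q : L.Q.PosSemidef
  posDef_R : L.R.PosDef
  posSemidef_P : L.P.PosSemidef
  posSemidef_H : ∀ i, (L.H i).PosSemidef
  detectable : Detectable L.A (CFC.sqrt L.Q)

/-- The affine parts of the constraints: at time `t` they read
`xᵀ Hᵢ x + c t i ⬝ x + d t i ≤ 0` for the state and `G t * u + e t ≤ 0` for the input. -/
structure AffineData (n m s : ℕ) (ι : Type*) where
  c : ℕ → ι → Fin n → ℝ
  d : ℕ → ι → ℝ
  G : ℕ → Matrix (Fin s) (Fin m) ℝ
  e : ℕ → Fin s → ℝ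

namespace LQR

variable {n m s : ℕ} {ι : Type*} [Fintype ι]

/-- The auxiliary weight `Q_λ = Q + ∑ᵢ λᵢ Hᵢ` belonging to the multipliers of one time instant. -/
def Qlam (L : LQR n m ι) (lam : ι → ℝ) : Matrix (Fin n) (Fin n) ℝ :=
  L.Q + ∑ i, lam i • L.H i

/-- The stage cost of the Lagrangian at time `t`. -/
def stageCost (L : LQR n m ι) (D : AffineData n m s ι) (lam : ℕ → ι → ℝ) (mu : ℕ → Fin s → ℝ)
    (t : ℕ) (x : Fin n → ℝ) (u : Fin m → ℝ) : ℝ :=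
  x ⬝ᵥ (L.Qlam (lam t) *ᵥ x) + (∑ i, lam t i • D.c t i) ⬝ᵥ x + lam t ⬝ᵥ D.d t
    + mu t ⬝ᵥ (D.G t *ᵥ u + D.e t) + u ⬝ᵥ (L.R *ᵥ u)

/-- The Lagrangian cost over `t, …, T` of a state sequence `x` and an input sequence `u`. -/
def costToGo (L : LQR n m ι) (D : AffineData n m s ι) (lam : ℕ → ι → ℝ) (mu : ℕ → Fin s → ℝ)
    (T t : ℕ) (x : ℕ → Fin n → ℝ) (u : ℕ → Fin m → ℝ) : ℝ :=
  x T ⬝ᵥ (L.P *ᵥ x T) + ∑ k ∈ Finset.Ico t T, L.stageCost D lam mu k (x k) (u k)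

/-- `M = R + Bᵀ F B`. -/
def M (L : LQR n m ι) (F : Matrix (Fin n) (Fin n) ℝ) : Matrix (Fin m) (Fin m) ℝ :=
  L.Bᵀ * F * L.B + L.R

/-- `K = M⁻¹ Bᵀ F A`. -/
def K (L : LQR n m ι) (F : Matrix (Fin n) (Fin n) ℝ) : Matrix (Fin m) (Fin n) ℝ :=
  (L.M F)⁻¹ * L.Bᵀ * F * L.A

/-- One backward step `Aᵀ F A + Q_λ - Aᵀ F B M⁻¹ Bᵀ F A` of the Riccati recursion. -/
def riccatiStep (L : LQR n m ι) (lam : ι → ℝ) (F : Matrix (Fin n) (Fin n) ℝ) :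
    Matrix (Fin n) (Fin n) ℝ :=
  L.Aᵀ * F * L.A + L.Qlam lam - L.Aᵀ * F * L.B * (L.M F)⁻¹ * L.Bᵀ * F * L.A

/-- The Riccati recursion for the horizon `T`, indexed by the number `k` of steps to go:
`Fback T k` is the matrix of the quadratic part of the cost-to-go at time `T - k`. -/
def Fback (L : LQR n m ι) (lam : ℕ → ι → ℝ) (T : ℕ) : ℕ → Matrix (Fin n) (Fin n) ℝ
  | 0 => L.P
  | k + 1 => L.riccatiStep (lam (T - (k + 1))) (Fback L lam T k)

/-- The matrix `F_t` for the horizon `T` (meaningful for `t ≤ T`). -/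
def F (L : LQR n m ι) (lam : ℕ → ι → ℝ) (T t : ℕ) : Matrix (Fin n) (Fin n) ℝ :=
  L.Fback lam T (T - t)

/-- One backward step, to time `t`, of the recursion for the linear part of the cost-to-go:
`S_tᵀ = ∑ᵢ λᵢ cᵢᵀ + Sᵀ A - (Sᵀ B + μ_tᵀ G_t) M⁻¹ Bᵀ F A`, where `F = F_{t+1}` and `S = S_{t+1}`. -/
def linStep (L : LQR n m ι) (D : AffineData n m s ι) (lam : ℕ → ι → ℝ) (mu : ℕ → Fin s → ℝ)
    (t : ℕ) (F : Matrix (Fin n) (Fin n) ℝ) (S : Fin n → ℝ) : Fin n → ℝ :=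
  (∑ i, lam t i • D.c t i) + L.Aᵀ *ᵥ S
    - (L.K F)ᵀ *ᵥ (L.Bᵀ *ᵥ S + (D.G t)ᵀ *ᵥ mu t)

/-- The recursion for the linear part of the cost-to-go, indexed by the steps to go. -/
def Sback (L : LQR n m ι) (D : AffineData n m s ι) (lam : ℕ → ι → ℝ) (mu : ℕ → Fin s → ℝ)
    (T : ℕ) : ℕ → Fin n → ℝ
  | 0 => 0
  | k + 1 => L.linStep D lam mu (T - (k + 1)) (Fback L lam T k) (Sback L D lam mu T k)

/-- The vector `S_t` for the horizon `T` (meaningful for `t ≤ T`). -/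
def S (L : LQR n m ι) (D : AffineData n m s ι) (lam : ℕ → ι → ℝ) (mu : ℕ → Fin s → ℝ)
    (T t : ℕ) : Fin n → ℝ :=
  L.Sback D lam mu T (T - t)

/-- The offset `l_t` of the optimal law. -/
def offset (L : LQR n m ι) (D : AffineData n m s ι) (lam : ℕ → ι → ℝ) (mu : ℕ → Fin s → ℝ)
    (T t : ℕ) : Fin m → ℝ :=
  -((1 / 2 : ℝ) • ((L.M (L.F lam T (t + 1)))⁻¹ *ᵥ
    (L.Bᵀ *ᵥ L.S D lam mu T (t + 1) + (D.G t)ᵀ *ᵥ mu t)))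

/-- The optimal law `u_t^*(x, λ, μ) = -K_t x + l_t` for the horizon `T` (meaningful for `t < T`). -/
def law (L : LQR n m ι) (D : AffineData n m s ι) (lam : ℕ → ι → ℝ) (mu : ℕ → Fin s → ℝ)
    (T t : ℕ) (x : Fin n → ℝ) : Fin m → ℝ :=
  -(L.K (L.F lam T (t + 1)) *ᵥ x) + L.offset D lam mu T t

/-- `x` is a trajectory, from time `t` up to time `T`, of the system driven by the inputs `u`. -/
def IsTrajectory (L : LQR n m ι) (t T : ℕ) (x : ℕ → Fin n → ℝ) (u : ℕ → Fin m → ℝ) : Prop :=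
  ∀ k, t ≤ k → k < T → x (k + 1) = L.A *ᵥ x k + L.B *ᵥ u k

end LQR

end

/-!
Completing the square with the Riccati matrices `F_t` writes the cost-to-go of every input sequence
as a function of the initial state, plus constants, plus `∑ (u_k - u_k^*)ᵀ M_k (u_k - u_k^*)`,
whence the optimality of the law. A fixed stabilizing gain bounds `F_t` uniformly in the horizon,
and detectability yields a seminorm `N ≥ ‖·‖` with
`N (A x + B u)² ≤ θ N(x)² + γ (xᵀ Q x + uᵀ R u)` and `θ < 1`; hence `γ xᵀ F_t x + N(x)²` is a
Lyapunov function which the homogeneous closed loop contracts at a rate independent of the horizon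
and of the multipliers below `Λ`.

For time-invariant data the difference of two Riccati solutions is transported by the transition
matrices `Φ` of the two closed loops, `F_0 - F_0' = Φᵀ (F_t - F_t') Φ'`, so that `F_0` is a Cauchy
sequence in the horizon. The limit inherits the decay, and `S_0` follows an affine iteration whose
coefficients converge, with a Schur stable limit matrix.
-/

section SchurStability

section OperatorNorm

attribute [local instance] Matrix.linftyOpNormedAddCommGroup Matrix.linftyOpNormedSpace
  Matrix.linftyOpNormedRing Matrix.linftyOpNormedAlgebra

theorem linfty_opNorm_map_ofReal_pow {p : Type*} [Fintype p] [DecidableEq p] (A : Matrix p p ℝ)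
    (k : ℕ) : ‖A.map (fun a : ℝ => (a : ℂ)) ^ k‖ = ‖A ^ k‖ := by
  have h : A.map (fun a : ℝ => (a : ℂ)) ^ k = (A ^ k).map (fun a : ℝ => (a : ℂ)) :=
    (map_pow Complex.ofRealHom.mapMatrix A k).symm
  simp [h, Matrix.linfty_opNorm_def]

theorem spectralRadius_lt_one_of_norm_pow_mul_lt_one {R : Type*} [NormedRing R]
    [NormedAlgebra ℂ R] [CompleteSpace R] {a : R} {k : ℕ} (hk : k ≠ 0)
    (h : ‖a ^ k‖ * ‖(1 : R)‖ < 1) : spectralRadius ℂ a < 1 := by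
  have hle : spectralRadius ℂ (a ^ k) ≤ ‖a ^ k‖₊ * ‖(1 : R)‖₊ :=
    iSup₂_le fun z hz => by exact_mod_cast spectrum.norm_le_norm_mul_of_mem hz
  have hlt : (‖a ^ k‖₊ * ‖(1 : R)‖₊ : ENNReal) < 1 := by exact_mod_cast h
  exact (pow_lt_one_iff hk).1 (((spectrum.spectralRadius_pow_le a k hk).trans hle).trans_lt hlt)

theorem SchurStable.exists_norm_pow_mulVec_le {n : ℕ} {A : Matrix (Fin n) (Fin n) ℝ}
    (hA : SchurStable A) :
    ∃ θ : NNReal, 0 < θ ∧ θ < 1 ∧ ∃ k ≠ 0, ∀ x, ‖A ^ k *ᵥ x‖ ≤ θ ^ k * ‖x‖ := by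
  obtain ⟨θ, hAθ, hθ1⟩ := ENNReal.lt_iff_exists_nnreal_btwn.1 hA
  have hθ0 : 0 < θ := ENNReal.coe_pos.1 (bot_le.trans_lt hAθ)
  have hgelfand := (spectrum.pow_nnnorm_pow_one_div_tendsto_nhds_spectralRadius
    (A.map (fun a : ℝ => (a : ℂ)))).eventually (gt_mem_nhds hAθ)
  obtain ⟨k, hk, hk0⟩ := (hgelfand.and (eventually_ne_atTop 0)).exists
  rw [one_div, ENNReal.rpow_inv_lt_iff (by positivity), ENNReal.rpow_natCast] at hk
  have hnorm : ‖A ^ k‖ ≤ (θ : ℝ) ^ k := by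
    rw [← linfty_opNorm_map_ofReal_pow]
    exact_mod_cast hk.le
  exact ⟨θ, hθ0, by exact_mod_cast hθ1, k, hk0, fun x =>
    (Matrix.linfty_opNorm_mulVec _ _).trans (by gcongr)⟩

theorem SchurStable.of_norm_pow_mulVec_le {n : ℕ} {A : Matrix (Fin n) (Fin n) ℝ} {C α : ℝ}
    (hC : 0 ≤ C) (hα0 : 0 ≤ α) (hα1 : α < 1) (h : ∀ k x, ‖A ^ k *ᵥ x‖ ≤ C * α ^ k * ‖x‖) :
    SchurStable A := by
  have hnorm (k : ℕ) : ‖A ^ k‖ ≤ C * α ^ k :=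
    (Matrix.linfty_opNorm_eq_opNorm _).trans_le
      (ContinuousLinearMap.opNorm_le_bound _ (by positivity) (h k))
  have hlim : Tendsto (fun k => C * α ^ k * ‖(1 : Matrix (Fin n) (Fin n) ℂ)‖) atTop (𝓝 0) := by
    simpa using ((tendsto_pow_atTop_nhds_zero_of_lt_one hα0 hα1).const_mul C).mul_const _
  obtain ⟨k, hk, hk0⟩ := ((hlim.eventually_lt_const one_pos).and (eventually_ne_atTop 0)).exists
  refine spectralRadius_lt_one_of_norm_pow_mul_lt_one hk0 (lt_of_le_of_lt ?_ hk)
  rw [linfty_opNorm_map_ofReal_pow]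
  gcongr
  exact hnorm k

end OperatorNorm

variable {n : ℕ} {A : Matrix (Fin n) (Fin n) ℝ}

theorem SchurStable.transpose (hA : SchurStable A) : SchurStable Aᵀ := by
  have hspec : spectrum ℂ (Aᵀ.map (fun a : ℝ => (a : ℂ)))
      = spectrum ℂ (A.map (fun a : ℝ => (a : ℂ))) := by
    ext z
    rw [spectrum.mem_iff, spectrum.mem_iff, ← Matrix.isUnit_transpose, Matrix.transpose_sub,
      Matrix.transpose_map, Matrix.transpose_transpose, Matrix.algebraMap_eq_diagonal,
      Matrix.diagonal_transpose]
  rw [SchurStable, spectralRadius, hspec]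
  exact hA

theorem SchurStable.isUnit_one_sub (hA : SchurStable A) : IsUnit (1 - A) := by
  have hmem : (1 : ℂ) ∈ resolventSet ℂ (A.map (fun a : ℝ => (a : ℂ))) :=
    spectrum.mem_resolventSet_of_spectralRadius_lt (by simpa [SchurStable] using hA)
  have hmap : algebraMap ℂ (Matrix (Fin n) (Fin n) ℂ) 1 - A.map (fun a : ℝ => (a : ℂ))
      = Complex.ofRealHom.mapMatrix (1 - A) := by
    rw [map_one, map_sub, map_one]
    rfl
  rw [spectrum.mem_resolventSet_iff, hmap, Matrix.isUnit_iff_isUnit_det, ← RingHom.map_det] at hmem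
  rw [Matrix.isUnit_iff_isUnit_det]
  exact isUnit_iff_ne_zero.2 fun h => hmem.ne_zero (by rw [h, map_zero])

theorem SchurStable.exists_eq_mulVec_add (hA : SchurStable A) (w : Fin n → ℝ) :
    ∃ x, x = A *ᵥ x + w := by
  obtain ⟨x, hx⟩ := Matrix.mulVec_surjective_iff_isUnit.2 hA.isUnit_one_sub w
  exact ⟨x, by rw [← hx, Matrix.sub_mulVec, Matrix.one_mulVec, add_sub_cancel]⟩

theorem sub_eq_pow_mulVec_sub {p R : Type*} [Fintype p] [DecidableEq p] [Ring R]
    {A : Matrix p p R} {w y : p → R} {x : ℕ → p → R} (hy : y = A *ᵥ y + w)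
    (hx : ∀ t, x (t + 1) = A *ᵥ x t + w) (t : ℕ) : x t - y = A ^ t *ᵥ (x 0 - y) := by
  induction t with
  | zero => simp
  | succ t ih =>
    rw [pow_succ', ← Matrix.mulVec_mulVec, ← ih, hx, Matrix.mulVec_sub]
    nth_rw 1 [hy]
    abel

section OrbitSeminorm

variable {p : Type*} [Fintype p] [DecidableEq p]

/-- For a matrix `A` with `‖A ^ m x‖ ≤ θ ^ m ‖x‖`, the weighted orbit norm
`∑ k < m, θ⁻ᵏ ‖A ^ k x‖`, which `A` contracts by the factor `θ`. -/
noncomputable def orbitSeminorm (A : Matrix p p ℝ) (θ : NNReal) (m : ℕ) :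
    Seminorm ℝ (p → ℝ) :=
  ∑ k ∈ Finset.range m, (θ ^ k)⁻¹ • (normSeminorm ℝ (p → ℝ)).comp (A ^ k).mulVecLin

theorem orbitSeminorm_apply (A : Matrix p p ℝ) (θ : NNReal) (m : ℕ) (x : p → ℝ) :
    orbitSeminorm A θ m x = ∑ k ∈ Finset.range m, ((θ : ℝ) ^ k)⁻¹ * ‖A ^ k *ᵥ x‖ := by
  simp [orbitSeminorm, NNReal.smul_def]

theorem norm_le_orbitSeminorm (A : Matrix p p ℝ) (θ : NNReal) {m : ℕ} (hm : m ≠ 0)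
    (x : p → ℝ) : ‖x‖ ≤ orbitSeminorm A θ m x := by
  rw [orbitSeminorm_apply]
  simpa using Finset.single_le_sum (f := fun k => ((θ : ℝ) ^ k)⁻¹ * ‖A ^ k *ᵥ x‖)
    (fun k _ => by positivity) (Finset.mem_range.2 (Nat.pos_of_ne_zero hm))

theorem orbitSeminorm_mulVec_le {A : Matrix p p ℝ} {θ : NNReal} (hθ : 0 < θ) {m : ℕ}
    (hA : ∀ x, ‖A ^ m *ᵥ x‖ ≤ θ ^ m * ‖x‖) (x : p → ℝ) :
    orbitSeminorm A θ m (A *ᵥ x) ≤ θ * orbitSeminorm A θ m x := by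
  have hθ' : (0 : ℝ) < θ := hθ
  set f : ℕ → ℝ := fun k => ((θ : ℝ) ^ k)⁻¹ * ‖A ^ k *ᵥ x‖
  have hshift (k : ℕ) : ((θ : ℝ) ^ k)⁻¹ * ‖A ^ k *ᵥ (A *ᵥ x)‖ = θ * f (k + 1) := by
    simp only [f]
    rw [Matrix.mulVec_mulVec, ← pow_succ]
    field_simp
    ring
  have hlast : f m ≤ f 0 := by
    simpa [f, inv_mul_le_iff₀ (pow_pos hθ' m)] using hA x
  simp only [orbitSeminorm_apply, hshift, ← Finset.mul_sum]
  refine mul_le_mul_of_nonneg_left ?_ hθ'.le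
  linarith [Finset.sum_range_succ f m, Finset.sum_range_succ' f m]

end OrbitSeminorm

theorem SchurStable.exists_seminorm (hA : SchurStable A) :
    ∃ (N : Seminorm ℝ (Fin n → ℝ)) (θ : ℝ), 0 < θ ∧ θ < 1 ∧ (∀ x, ‖x‖ ≤ N x) ∧
      ∀ x, N (A *ᵥ x) ≤ θ * N x := by
  obtain ⟨θ, hθ0, hθ1, m, hm, hle⟩ := hA.exists_norm_pow_mulVec_le
  exact ⟨orbitSeminorm A θ m, θ, hθ0, hθ1, norm_le_orbitSeminorm A θ hm,
    orbitSeminorm_mulVec_le hθ0 hle⟩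

theorem exists_seminorm_le_mul_norm {p : Type*} [Fintype p] (N : Seminorm ℝ (p → ℝ)) :
    ∃ a : ℝ, 0 < a ∧ ∀ x, N x ≤ a * ‖x‖ := by
  classical
  have hsum : 0 ≤ ∑ i, N (Pi.single i 1) := Finset.sum_nonneg fun i _ => apply_nonneg N _
  refine ⟨∑ i, N (Pi.single i 1) + 1, add_pos_of_nonneg_of_pos hsum one_pos, fun x => ?_⟩
  calc N x = N (∑ i, x i • Pi.single i 1) := by rw [← pi_eq_sum_univ' x]
    _ ≤ ∑ i, N (x i • Pi.single i 1) :=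
        Finset.le_sum_of_subadditive N (map_zero N).le (map_add_le_add N) _ _
    _ ≤ ∑ i, N (Pi.single i 1) * ‖x‖ := by
        gcongr with i
        rw [map_smul_eq_mul, mul_comm]
        gcongr
        exact norm_le_pi_norm x i
    _ = (∑ i, N (Pi.single i 1)) * ‖x‖ := (Finset.sum_mul _ _ _).symm
    _ ≤ (∑ i, N (Pi.single i 1) + 1) * ‖x‖ := by
        gcongr
        exact le_add_of_nonneg_right one_pos.le

end SchurStability

section QuadraticForms

variable {p q : Type*} [Fintype p] [Fintype q]

theorem sq_norm_le_dotProduct_self (x : p → ℝ) : ‖x‖ ^ 2 ≤ x ⬝ᵥ x := by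
  have h0 : 0 ≤ x ⬝ᵥ x := Finset.sum_nonneg fun i _ => mul_self_nonneg _
  rw [← Real.le_sqrt (norm_nonneg _) h0, pi_norm_le_iff_of_nonneg (Real.sqrt_nonneg _)]
  intro i
  refine Real.abs_le_sqrt ?_
  rw [sq]
  exact Finset.single_le_sum (f := fun i => x i * x i) (fun i _ => mul_self_nonneg _)
    (Finset.mem_univ i)

theorem exists_abs_dotProduct_mulVec_le (X : Matrix p q ℝ) :
    ∃ c : ℝ, 0 ≤ c ∧ ∀ x y, |x ⬝ᵥ (X *ᵥ y)| ≤ c * (‖x‖ * ‖y‖) := by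
  refine ⟨∑ i, ∑ j, |X i j|, by positivity, fun x y => ?_⟩
  simp only [dotProduct, Matrix.mulVec, Finset.mul_sum, Finset.sum_mul]
  refine (Finset.abs_sum_le_sum_abs _ _).trans (Finset.sum_le_sum fun i _ => ?_)
  refine (Finset.abs_sum_le_sum_abs _ _).trans (Finset.sum_le_sum fun j _ => ?_)
  rw [abs_mul, abs_mul, mul_left_comm]
  gcongr
  · exact norm_le_pi_norm x i
  · exact norm_le_pi_norm y j

theorem exists_dotProduct_mulVec_self_le (X : Matrix p p ℝ) :
    ∃ c : ℝ, 0 ≤ c ∧ ∀ x, x ⬝ᵥ (X *ᵥ x) ≤ c * ‖x‖ ^ 2 := by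
  obtain ⟨c, hc0, hc⟩ := exists_abs_dotProduct_mulVec_le X
  exact ⟨c, hc0, fun x => by rw [sq]; exact (le_abs_self _).trans (hc x x)⟩

theorem dotProduct_mulVec_self_nonneg {X : Matrix p p ℝ} (hX : X.PosSemidef) (x : p → ℝ) :
    0 ≤ x ⬝ᵥ (X *ᵥ x) :=
  hX.dotProduct_mulVec_nonneg x

theorem dotProduct_mulVec_self_mono {X Y : Matrix p p ℝ} (h : X ≤ Y) (x : p → ℝ) :
    x ⬝ᵥ (X *ᵥ x) ≤ x ⬝ᵥ (Y *ᵥ x) := by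
  have hsub := dotProduct_mulVec_self_nonneg (Matrix.le_iff.1 h) x
  rwa [Matrix.sub_mulVec, dotProduct_sub, sub_nonneg] at hsub

theorem isSymm_of_posSemidef {p : Type*} {X : Matrix p p ℝ} (hX : X.PosSemidef) : X.IsSymm :=
  Matrix.isHermitian_iff_isSymm.1 hX.isHermitian

theorem dotProduct_mulVec_comm_of_isSymm {R : Type*} [CommSemiring R] {X : Matrix p p R}
    (hX : X.IsSymm) (x y : p → R) : x ⬝ᵥ (X *ᵥ y) = y ⬝ᵥ (X *ᵥ x) := by
  conv_lhs => rw [← hX.eq]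
  exact Matrix.dotProduct_transpose_mulVec X x y

theorem dotProduct_mulVec_self_add_dotProduct {X : Matrix p p ℝ} (hX : X.IsSymm)
    {b l : p → ℝ} (hl : X *ᵥ l = -((1 / 2 : ℝ) • b)) (v : p → ℝ) :
    v ⬝ᵥ (X *ᵥ v) + b ⬝ᵥ v = (v - l) ⬝ᵥ (X *ᵥ (v - l)) - l ⬝ᵥ (X *ᵥ l) := by
  have hlin : v ⬝ᵥ (X *ᵥ l) = -(1 / 2) * (b ⬝ᵥ v) := by
    rw [hl, dotProduct_neg, dotProduct_smul, smul_eq_mul, dotProduct_comm]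
    ring
  have hcomm := dotProduct_mulVec_comm_of_isSymm hX l v
  simp only [Matrix.mulVec_sub, dotProduct_sub, sub_dotProduct]
  linarith

theorem dotProduct_transpose_mul_mul_mulVec {R p' q' : Type*} [CommSemiring R] [Fintype p']
    [Fintype q'] (X : Matrix p p' R) (F : Matrix p q R) (Y : Matrix q q' R) (x : p' → R)
    (y : q' → R) : x ⬝ᵥ ((Xᵀ * F * Y) *ᵥ y) = (X *ᵥ x) ⬝ᵥ (F *ᵥ (Y *ᵥ y)) := by
  rw [← Matrix.mulVec_mulVec, ← Matrix.mulVec_mulVec, Matrix.dotProduct_transpose_mulVec,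
    dotProduct_comm]

theorem dotProduct_mulVec_self_eq_sqrt [DecidableEq p] {X : Matrix p p ℝ} (hX : X.PosSemidef)
    (x : p → ℝ) : x ⬝ᵥ (X *ᵥ x) = (CFC.sqrt X *ᵥ x) ⬝ᵥ (CFC.sqrt X *ᵥ x) := by
  have hsqrt : (CFC.sqrt X).IsSymm :=
    isSymm_of_posSemidef (Matrix.nonneg_iff_posSemidef.1 (CFC.sqrt_nonneg X))
  rw [dotProduct_mulVec_comm_of_isSymm hsqrt, Matrix.mulVec_mulVec,
    CFC.sqrt_mul_sqrt_self X (Matrix.nonneg_iff_posSemidef.2 hX)]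

theorem sq_norm_sqrt_mulVec_le [DecidableEq p] {X : Matrix p p ℝ} (hX : X.PosSemidef) (x : p → ℝ) :
    ‖CFC.sqrt X *ᵥ x‖ ^ 2 ≤ x ⬝ᵥ (X *ᵥ x) :=
  (sq_norm_le_dotProduct_self _).trans_eq (dotProduct_mulVec_self_eq_sqrt hX x).symm

theorem exists_mul_sq_norm_le_dotProduct_mulVec_self {X : Matrix p p ℝ} (hX : X.PosDef) :
    ∃ r : ℝ, 0 < r ∧ ∀ x, r * ‖x‖ ^ 2 ≤ x ⬝ᵥ (X *ᵥ x) := by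
  classical
  have hker : LinearMap.ker (CFC.sqrt X).mulVecLin = ⊥ := by
    refine LinearMap.ker_eq_bot'.2 fun x hx => ?_
    by_contra hx0
    have hpos : 0 < x ⬝ᵥ (X *ᵥ x) := hX.dotProduct_mulVec_pos hx0
    rw [dotProduct_mulVec_self_eq_sqrt hX.posSemidef, ← Matrix.mulVecLin_apply, hx] at hpos
    simp at hpos
  obtain ⟨a, ha, hanti⟩ := LinearMap.exists_antilipschitzWith _ hker
  refine ⟨((a : ℝ) ^ 2)⁻¹, by positivity, fun x => ?_⟩
  rw [inv_mul_le_iff₀ (by positivity)]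
  calc ‖x‖ ^ 2 ≤ (a * ‖CFC.sqrt X *ᵥ x‖) ^ 2 := by
        gcongr
        exact hanti.le_mul_norm (map_zero _) x
    _ = a ^ 2 * ‖CFC.sqrt X *ᵥ x‖ ^ 2 := mul_pow _ _ _
    _ ≤ a ^ 2 * (x ⬝ᵥ (X *ᵥ x)) := by gcongr; exact sq_norm_sqrt_mulVec_le hX.posSemidef x

end QuadraticForms

section Detectability

theorem exists_eq_mul_of_ker_le {𝕜 p q r : Type*} [Field 𝕜] [Fintype q] [Fintype r]
    {C : Matrix p r 𝕜} {D : Matrix q r 𝕜} (h : ∀ x, D *ᵥ x = 0 → C *ᵥ x = 0) :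
    ∃ X : Matrix p q 𝕜, C = X * D := by
  classical
  obtain ⟨s, hs⟩ := D.mulVecLin.rangeRestrict.exists_rightInverse_of_surjective
    (LinearMap.range_rangeRestrict _)
  obtain ⟨g, hg⟩ := LinearMap.exists_extend s
  refine ⟨LinearMap.toMatrix' (C.mulVecLin ∘ₗ g), Matrix.ext_of_mulVec_single fun i => ?_⟩
  set x : r → 𝕜 := Pi.single i 1
  have hgs : g (D *ᵥ x) = s (D.mulVecLin.rangeRestrict x) :=
    LinearMap.congr_fun hg (D.mulVecLin.rangeRestrict x)
  have hDs : D *ᵥ s (D.mulVecLin.rangeRestrict x) = D *ᵥ x :=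
    congrArg Subtype.val (LinearMap.congr_fun hs (D.mulVecLin.rangeRestrict x))
  have hC : C *ᵥ (x - g (D *ᵥ x)) = 0 := h _ (by rw [Matrix.mulVec_sub, hgs, hDs, sub_self])
  rwa [← Matrix.mulVec_mulVec, LinearMap.toMatrix'_mulVec, LinearMap.comp_apply,
    Matrix.mulVecLin_apply, ← sub_eq_zero, ← Matrix.mulVec_sub]

variable {n p q : ℕ} {A : Matrix (Fin n) (Fin n) ℝ}

theorem Detectable.of_ker_le {C : Matrix (Fin p) (Fin n) ℝ} {D : Matrix (Fin q) (Fin n) ℝ}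
    (hC : Detectable A C) (h : ∀ x, D *ᵥ x = 0 → C *ᵥ x = 0) : Detectable A D := by
  obtain ⟨X, rfl⟩ := exists_eq_mul_of_ker_le h
  obtain ⟨Y, hY⟩ := hC
  exact ⟨Y * X, by rwa [Matrix.mul_assoc]⟩

theorem Detectable.sqrt_mono {Q₁ Q₂ : Matrix (Fin n) (Fin n) ℝ} (hQ₁ : 0 ≤ Q₁) (hle : Q₁ ≤ Q₂)
    (hA : Detectable A (CFC.sqrt Q₁)) : Detectable A (CFC.sqrt Q₂) := by
  refine hA.of_ker_le fun x hx => ?_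
  have hform := dotProduct_mulVec_self_mono hle x
  rw [dotProduct_mulVec_self_eq_sqrt (Matrix.nonneg_iff_posSemidef.1 (hQ₁.trans hle)), hx,
    zero_dotProduct] at hform
  have hnorm := (sq_norm_sqrt_mulVec_le (Matrix.nonneg_iff_posSemidef.1 hQ₁) x).trans hform
  exact norm_eq_zero.1 (pow_eq_zero_iff two_ne_zero |>.1 (le_antisymm hnorm (sq_nonneg _)))

theorem mul_add_sq_le {θ x w : ℝ} (hθ0 : 0 ≤ θ) (hθ1 : θ < 1) :
    (θ * x + w) ^ 2 ≤ θ * x ^ 2 + w ^ 2 / (1 - θ) := by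
  have hθ : 0 < 1 - θ := sub_pos.2 hθ1
  have hgap : θ * x ^ 2 + w ^ 2 / (1 - θ) - (θ * x + w) ^ 2
      = θ / (1 - θ) * ((1 - θ) * x - w) ^ 2 := by
    field_simp
    ring
  have hgap0 : 0 ≤ θ / (1 - θ) * ((1 - θ) * x - w) ^ 2 := by positivity
  linarith

theorem Detectable.exists_seminorm_sq_le {m : ℕ} {C : Matrix (Fin p) (Fin n) ℝ}
    (hC : Detectable A C) (B : Matrix (Fin n) (Fin m) ℝ) :
    ∃ (N : Seminorm ℝ (Fin n → ℝ)) (θ γ : ℝ), 0 < θ ∧ θ < 1 ∧ 0 ≤ γ ∧ (∀ x, ‖x‖ ≤ N x) ∧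
      ∀ x u, N (A *ᵥ x + B *ᵥ u) ^ 2 ≤ θ * N x ^ 2 + γ * (‖C *ᵥ x‖ ^ 2 + ‖u‖ ^ 2) := by
  obtain ⟨Y, hY⟩ := hC
  obtain ⟨N, θ, hθ0, hθ1, hle, hN⟩ := hY.exists_seminorm
  obtain ⟨y, hy0, hy⟩ := exists_seminorm_le_mul_norm (N.comp Y.mulVecLin)
  obtain ⟨b, hb0, hb⟩ := exists_seminorm_le_mul_norm (N.comp B.mulVecLin)
  refine ⟨N, θ, (y ^ 2 + b ^ 2) / (1 - θ), hθ0, hθ1,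
    div_nonneg (by positivity) (sub_nonneg.2 hθ1.le), hle, fun x u => ?_⟩
  set w := y * ‖C *ᵥ x‖ + b * ‖u‖
  have hobserver : A *ᵥ x + B *ᵥ u = (A - Y * C) *ᵥ x + (Y *ᵥ (C *ᵥ x) + B *ᵥ u) := by
    rw [Matrix.sub_mulVec, Matrix.mulVec_mulVec]
    abel
  have hstep : N (A *ᵥ x + B *ᵥ u) ≤ θ * N x + w := by
    rw [hobserver]
    exact (map_add_le_add N _ _).trans
      (add_le_add (hN x) ((map_add_le_add N _ _).trans (add_le_add (hy _) (hb u))))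
  have hcauchy : w ^ 2 ≤ (y ^ 2 + b ^ 2) * (‖C *ᵥ x‖ ^ 2 + ‖u‖ ^ 2) := by
    linarith [sq_nonneg (y * ‖u‖ - b * ‖C *ᵥ x‖)]
  calc N (A *ᵥ x + B *ᵥ u) ^ 2 ≤ (θ * N x + w) ^ 2 := by gcongr
    _ ≤ θ * N x ^ 2 + w ^ 2 / (1 - θ) := mul_add_sq_le hθ0.le hθ1
    _ ≤ θ * N x ^ 2 + (y ^ 2 + b ^ 2) * (‖C *ᵥ x‖ ^ 2 + ‖u‖ ^ 2) / (1 - θ) := by gcongr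
    _ = _ := by ring

theorem Detectable.exists_seminorm_sq_le_form {m : ℕ} {Q : Matrix (Fin n) (Fin n) ℝ}
    {R : Matrix (Fin m) (Fin m) ℝ} (hQ : Q.PosSemidef) (hR : R.PosDef)
    (hA : Detectable A (CFC.sqrt Q)) (B : Matrix (Fin n) (Fin m) ℝ) :
    ∃ (N : Seminorm ℝ (Fin n → ℝ)) (θ γ : ℝ), 0 < θ ∧ θ < 1 ∧ 0 ≤ γ ∧ (∀ x, ‖x‖ ≤ N x) ∧
      ∀ x u, N (A *ᵥ x + B *ᵥ u) ^ 2 ≤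
        θ * N x ^ 2 + γ * (x ⬝ᵥ (Q *ᵥ x) + u ⬝ᵥ (R *ᵥ u)) := by
  obtain ⟨N, θ, γ, hθ0, hθ1, hγ, hle, hN⟩ := hA.exists_seminorm_sq_le B
  obtain ⟨r, hr0, hr⟩ := exists_mul_sq_norm_le_dotProduct_mulVec_self hR
  refine ⟨N, θ, γ * (1 + r⁻¹), hθ0, hθ1, by positivity, hle, fun x u => (hN x u).trans ?_⟩
  have hx : ‖CFC.sqrt Q *ᵥ x‖ ^ 2 ≤ x ⬝ᵥ (Q *ᵥ x) := sq_norm_sqrt_mulVec_le hQ x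
  have hu : ‖u‖ ^ 2 ≤ r⁻¹ * (u ⬝ᵥ (R *ᵥ u)) := (le_inv_mul_iff₀ hr0).2 (hr u)
  have hx0 : 0 ≤ r⁻¹ * (x ⬝ᵥ (Q *ᵥ x)) :=
    mul_nonneg (inv_nonneg.2 hr0.le) (dotProduct_mulVec_self_nonneg hQ x)
  have hu0 : 0 ≤ u ⬝ᵥ (R *ᵥ u) := dotProduct_mulVec_self_nonneg hR.posSemidef u
  rw [mul_assoc]
  gcongr
  linarith

end Detectability

namespace LQR

section Gain

variable {n m : ℕ} {ι : Type*}

/-- The closed-loop matrix `A - B K` of the feedback gain belonging to `F`. -/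
noncomputable def closedLoop (L : LQR n m ι) (F : Matrix (Fin n) (Fin n) ℝ) :
    Matrix (Fin n) (Fin n) ℝ :=
  L.A - L.B * L.K F

variable {L : LQR n m ι} {F : Matrix (Fin n) (Fin n) ℝ}

theorem closedLoop_mulVec (x : Fin n → ℝ) :
    L.closedLoop F *ᵥ x = L.A *ᵥ x + L.B *ᵥ (-(L.K F *ᵥ x)) := by
  rw [closedLoop, Matrix.sub_mulVec, Matrix.mulVec_neg, Matrix.mulVec_mulVec, sub_eq_add_neg]

theorem M_posDef (hR : L.R.PosDef) (hF : F.PosSemidef) : (L.M F).PosDef :=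
  Matrix.PosDef.posSemidef_add (hF.conjTranspose_mul_mul_same L.B) hR

theorem M_isSymm (hR : L.R.PosDef) (hF : F.PosSemidef) : (L.M F).IsSymm :=
  isSymm_of_posSemidef (M_posDef hR hF).posSemidef

theorem isUnit_det_M (hR : L.R.PosDef) (hF : F.PosSemidef) : IsUnit (L.M F).det :=
  (Matrix.isUnit_iff_isUnit_det _).1 (M_posDef hR hF).isUnit

theorem M_mul_K (hR : L.R.PosDef) (hF : F.PosSemidef) :
    L.M F * L.K F = L.Bᵀ * F * L.A := by
  simp only [K, ← Matrix.mul_assoc]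
  rw [Matrix.mul_nonsing_inv _ (isUnit_det_M hR hF), Matrix.one_mul]

theorem K_transpose_mul_M (hR : L.R.PosDef) (hF : F.PosSemidef) :
    (L.K F)ᵀ * L.M F = L.Aᵀ * F * L.B := by
  have h := congrArg Matrix.transpose (M_mul_K hR hF)
  simpa only [Matrix.transpose_mul, Matrix.transpose_transpose, (isSymm_of_posSemidef hF).eq,
    (M_isSymm hR hF).eq, Matrix.mul_assoc] using h

theorem complete_square_gain (hR : L.R.PosDef) (hF : F.PosSemidef)
    (x : Fin n → ℝ) (u : Fin m → ℝ) :
    (L.A *ᵥ x + L.B *ᵥ u) ⬝ᵥ (F *ᵥ (L.A *ᵥ x + L.B *ᵥ u)) + u ⬝ᵥ (L.R *ᵥ u)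
      = (L.A *ᵥ x) ⬝ᵥ (F *ᵥ (L.A *ᵥ x)) - (L.K F *ᵥ x) ⬝ᵥ (L.M F *ᵥ (L.K F *ᵥ x))
        + (u + L.K F *ᵥ x) ⬝ᵥ (L.M F *ᵥ (u + L.K F *ᵥ x)) := by
  have hcross : (L.B *ᵥ u) ⬝ᵥ (F *ᵥ (L.A *ᵥ x)) = u ⬝ᵥ (L.M F *ᵥ (L.K F *ᵥ x)) := by
    rw [← dotProduct_transpose_mul_mul_mulVec, ← M_mul_K hR hF, Matrix.mulVec_mulVec]
  have hu : u ⬝ᵥ (L.M F *ᵥ u) = (L.B *ᵥ u) ⬝ᵥ (F *ᵥ (L.B *ᵥ u)) + u ⬝ᵥ (L.R *ᵥ u) := by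
    rw [M, Matrix.add_mulVec, dotProduct_add, dotProduct_transpose_mul_mul_mulVec]
  have hFcomm := dotProduct_mulVec_comm_of_isSymm (isSymm_of_posSemidef hF) (L.A *ᵥ x) (L.B *ᵥ u)
  have hMcomm := dotProduct_mulVec_comm_of_isSymm (M_isSymm hR hF) (L.K F *ᵥ x) u
  simp only [Matrix.mulVec_add, dotProduct_add, add_dotProduct]
  linarith

theorem linear_part_eq_gain (S x : Fin n → ℝ) (g u : Fin m → ℝ) :
    S ⬝ᵥ (L.A *ᵥ x + L.B *ᵥ u) + g ⬝ᵥ u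
      = (L.Aᵀ *ᵥ S - (L.K F)ᵀ *ᵥ (L.Bᵀ *ᵥ S + g)) ⬝ᵥ x
        + (L.Bᵀ *ᵥ S + g) ⬝ᵥ (u + L.K F *ᵥ x) := by
  simp only [Matrix.mulVec_transpose, sub_dotProduct, add_dotProduct, dotProduct_add,
    ← Matrix.dotProduct_mulVec]
  ring

end Gain

section Riccati

variable {n m : ℕ} {ι : Type*} [Fintype ι] {L : LQR n m ι} {F : Matrix (Fin n) (Fin n) ℝ}

theorem riccatiStep_eq_sub (hR : L.R.PosDef) (hF : F.PosSemidef) (lam : ι → ℝ) :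
    L.riccatiStep lam F = L.Aᵀ * F * L.A + L.Qlam lam - (L.K F)ᵀ * L.M F * L.K F := by
  rw [K_transpose_mul_M hR hF]
  simp only [riccatiStep, K, Matrix.mul_assoc]

theorem riccatiStep_eq_closedLoop (hR : L.R.PosDef) (hF : F.PosSemidef) (lam : ι → ℝ) :
    L.riccatiStep lam F = (L.closedLoop F)ᵀ * F * L.closedLoop F + L.Qlam lam
      + (L.K F)ᵀ * L.R * L.K F := by
  have hAK : L.Aᵀ * F * L.B * L.K F = (L.K F)ᵀ * L.M F * L.K F := by
    rw [K_transpose_mul_M hR hF]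
  have hKA : (L.K F)ᵀ * (L.Bᵀ * F * L.A) = (L.K F)ᵀ * L.M F * L.K F := by
    rw [← M_mul_K hR hF, Matrix.mul_assoc]
  have hKK : (L.K F)ᵀ * L.M F * L.K F
      = (L.K F)ᵀ * (L.Bᵀ * F * L.B) * L.K F + (L.K F)ᵀ * L.R * L.K F := by
    rw [M, Matrix.mul_add, Matrix.add_mul]
  rw [riccatiStep_eq_sub hR hF, closedLoop, Matrix.transpose_sub, Matrix.transpose_mul]
  simp only [Matrix.sub_mul, Matrix.mul_sub, Matrix.mul_assoc] at hAK hKA hKK ⊢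
  rw [hAK, hKA, hKK]
  abel

theorem dotProduct_riccatiStep_mulVec_eq (hR : L.R.PosDef) (hF : F.PosSemidef) (lam : ι → ℝ)
    (x : Fin n → ℝ) :
    x ⬝ᵥ (L.riccatiStep lam F *ᵥ x) =
      (L.closedLoop F *ᵥ x) ⬝ᵥ (F *ᵥ (L.closedLoop F *ᵥ x)) + x ⬝ᵥ (L.Qlam lam *ᵥ x)
        + (L.K F *ᵥ x) ⬝ᵥ (L.R *ᵥ (L.K F *ᵥ x)) := by
  simp only [riccatiStep_eq_closedLoop hR hF, Matrix.add_mulVec, dotProduct_add,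
    dotProduct_transpose_mul_mul_mulVec]

theorem riccatiStep_complete_square (hR : L.R.PosDef) (hF : F.PosSemidef) (lam : ι → ℝ)
    (x : Fin n → ℝ) (u : Fin m → ℝ) :
    (L.A *ᵥ x + L.B *ᵥ u) ⬝ᵥ (F *ᵥ (L.A *ᵥ x + L.B *ᵥ u)) + x ⬝ᵥ (L.Qlam lam *ᵥ x)
        + u ⬝ᵥ (L.R *ᵥ u)
      = x ⬝ᵥ (L.riccatiStep lam F *ᵥ x)
        + (u + L.K F *ᵥ x) ⬝ᵥ (L.M F *ᵥ (u + L.K F *ᵥ x)) := by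
  have h := complete_square_gain hR hF x u
  simp only [riccatiStep_eq_sub hR hF, Matrix.sub_mulVec, Matrix.add_mulVec, dotProduct_sub,
    dotProduct_add _ (_ *ᵥ x), dotProduct_transpose_mul_mul_mulVec]
  linarith

theorem riccatiStep_affine_complete_square (hR : L.R.PosDef) (hF : F.PosSemidef) (lam : ι → ℝ)
    (S x : Fin n → ℝ) {g l : Fin m → ℝ}
    (hl : l = -((1 / 2 : ℝ) • ((L.M F)⁻¹ *ᵥ (L.Bᵀ *ᵥ S + g)))) (u : Fin m → ℝ) :
    (L.A *ᵥ x + L.B *ᵥ u) ⬝ᵥ (F *ᵥ (L.A *ᵥ x + L.B *ᵥ u)) + S ⬝ᵥ (L.A *ᵥ x + L.B *ᵥ u)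
        + x ⬝ᵥ (L.Qlam lam *ᵥ x) + g ⬝ᵥ u + u ⬝ᵥ (L.R *ᵥ u)
      = x ⬝ᵥ (L.riccatiStep lam F *ᵥ x)
        + (L.Aᵀ *ᵥ S - (L.K F)ᵀ *ᵥ (L.Bᵀ *ᵥ S + g)) ⬝ᵥ x
        + (u + L.K F *ᵥ x - l) ⬝ᵥ (L.M F *ᵥ (u + L.K F *ᵥ x - l)) - l ⬝ᵥ (L.M F *ᵥ l) := by
  have hMl : L.M F *ᵥ l = -((1 / 2 : ℝ) • (L.Bᵀ *ᵥ S + g)) := by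
    rw [hl, Matrix.mulVec_neg, Matrix.mulVec_smul, Matrix.mulVec_mulVec,
      Matrix.mul_nonsing_inv _ (isUnit_det_M hR hF), Matrix.one_mulVec]
  linarith [riccatiStep_complete_square hR hF lam x u,
    linear_part_eq_gain (L := L) (F := F) S x g u,
    dotProduct_mulVec_self_add_dotProduct (M_isSymm hR hF) hMl (u + L.K F *ᵥ x)]

theorem dotProduct_riccatiStep_mulVec_le (hR : L.R.PosDef) (hF : F.PosSemidef) (lam : ι → ℝ)
    (x : Fin n → ℝ) (u : Fin m → ℝ) :
    x ⬝ᵥ (L.riccatiStep lam F *ᵥ x) ≤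
      (L.A *ᵥ x + L.B *ᵥ u) ⬝ᵥ (F *ᵥ (L.A *ᵥ x + L.B *ᵥ u)) + x ⬝ᵥ (L.Qlam lam *ᵥ x)
        + u ⬝ᵥ (L.R *ᵥ u) := by
  rw [riccatiStep_complete_square hR hF]
  exact le_add_of_nonneg_right (dotProduct_mulVec_self_nonneg (M_posDef hR hF).posSemidef _)

theorem riccatiStep_posSemidef (hR : L.R.PosDef) (hF : F.PosSemidef) {lam : ι → ℝ}
    (hQ : (L.Qlam lam).PosSemidef) : (L.riccatiStep lam F).PosSemidef := by
  rw [riccatiStep_eq_closedLoop hR hF]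
  exact ((hF.conjTranspose_mul_mul_same _).add hQ).add
    (hR.posSemidef.conjTranspose_mul_mul_same _)

theorem sum_smul_H_posSemidef (hH : ∀ i, (L.H i).PosSemidef) {lam : ι → ℝ}
    (hlam : ∀ i, 0 ≤ lam i) : (∑ i, lam i • L.H i).PosSemidef :=
  Matrix.posSemidef_sum _ fun i _ => (hH i).smul (hlam i)

theorem Qlam_posSemidef (hQ : L.Q.PosSemidef) (hH : ∀ i, (L.H i).PosSemidef) {lam : ι → ℝ}
    (hlam : ∀ i, 0 ≤ lam i) : (L.Qlam lam).PosSemidef :=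
  hQ.add (sum_smul_H_posSemidef hH hlam)

theorem Q_le_Qlam (hH : ∀ i, (L.H i).PosSemidef) {lam : ι → ℝ} (hlam : ∀ i, 0 ≤ lam i) :
    L.Q ≤ L.Qlam lam := by
  rw [Matrix.le_iff, Qlam, add_sub_cancel_left]
  exact sum_smul_H_posSemidef hH hlam

theorem Standing.detectable_sqrt_Qlam (hL : L.Standing) {lam : ι → ℝ} (hlam : ∀ i, 0 ≤ lam i) :
    Detectable L.A (CFC.sqrt (L.Qlam lam)) :=
  hL.detectable.sqrt_mono (Matrix.nonneg_iff_posSemidef.2 hL.posSemidef_Q)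
    (Q_le_Qlam hL.posSemidef_H hlam)

theorem exists_dotProduct_Qlam_mulVec_le (hH : ∀ i, (L.H i).PosSemidef) (Λ : ℝ) :
    ∃ q : ℝ, 0 ≤ q ∧ ∀ lam : ι → ℝ, (∀ i, lam i ≤ Λ) → ∀ x,
      x ⬝ᵥ (L.Qlam lam *ᵥ x) ≤ q * ‖x‖ ^ 2 := by
  obtain ⟨q, hq0, hq⟩ := exists_dotProduct_mulVec_self_le (L.Q + ∑ i, Λ • L.H i)
  refine ⟨q, hq0, fun lam hlam x => le_trans ?_ (hq x)⟩
  simp only [Qlam, Matrix.add_mulVec, dotProduct_add, Matrix.sum_mulVec, dotProduct_sum,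
    Matrix.smul_mulVec, dotProduct_smul, smul_eq_mul]
  gcongr with i
  · exact dotProduct_mulVec_self_nonneg (hH i) x
  · exact hlam i

end Riccati

section Recursion

variable {n m s : ℕ} {ι : Type*} [Fintype ι] {L : LQR n m ι} {lam : ℕ → ι → ℝ} {T t : ℕ}

theorem Fback_posSemidef (hR : L.R.PosDef) (hP : L.P.PosSemidef)
    (hQ : ∀ t < T, (L.Qlam (lam t)).PosSemidef) : ∀ k ≤ T, (L.Fback lam T k).PosSemidef
  | 0, _ => hP
  | k + 1, hk => riccatiStep_posSemidef hR (Fback_posSemidef hR hP hQ k (by omega))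
      (hQ _ (by omega))

theorem F_posSemidef (hR : L.R.PosDef) (hP : L.P.PosSemidef)
    (hQ : ∀ t < T, (L.Qlam (lam t)).PosSemidef) (t : ℕ) : (L.F lam T t).PosSemidef :=
  Fback_posSemidef hR hP hQ _ (Nat.sub_le _ _)

theorem F_self (L : LQR n m ι) (lam : ℕ → ι → ℝ) (T : ℕ) : L.F lam T T = L.P := by
  simp [LQR.F, Fback]

theorem F_eq_riccatiStep (L : LQR n m ι) (lam : ℕ → ι → ℝ) (ht : t < T) :
    L.F lam T t = L.riccatiStep (lam t) (L.F lam T (t + 1)) := by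
  have hback : T - t = (T - (t + 1)) + 1 := by omega
  have htime : T - (T - (t + 1) + 1) = t := by omega
  rw [LQR.F, hback, Fback, htime, LQR.F]

theorem S_self (L : LQR n m ι) (D : AffineData n m s ι) (lam : ℕ → ι → ℝ) (mu : ℕ → Fin s → ℝ)
    (T : ℕ) : L.S D lam mu T T = 0 := by
  simp [LQR.S, Sback]

theorem S_eq_linStep (L : LQR n m ι) (D : AffineData n m s ι) (lam : ℕ → ι → ℝ)
    (mu : ℕ → Fin s → ℝ) (ht : t < T) :
    L.S D lam mu T t = L.linStep D lam mu t (L.F lam T (t + 1)) (L.S D lam mu T (t + 1)) := by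
  have hback : T - t = (T - (t + 1)) + 1 := by omega
  have htime : T - (T - (t + 1) + 1) = t := by omega
  rw [LQR.S, hback, Sback, htime, LQR.F, LQR.S]

/-- The part of the optimal cost-to-go contributed by one time step independently of the state. -/
noncomputable def costConst (L : LQR n m ι) (D : AffineData n m s ι) (lam : ℕ → ι → ℝ)
    (mu : ℕ → Fin s → ℝ) (T t : ℕ) : ℝ :=
  lam t ⬝ᵥ D.d t + mu t ⬝ᵥ D.e t
    - L.offset D lam mu T t ⬝ᵥ (L.M (L.F lam T (t + 1)) *ᵥ L.offset D lam mu T t)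

variable (D : AffineData n m s ι) (mu : ℕ → Fin s → ℝ)

theorem stageCost_add_eq (hR : L.R.PosDef) (hF : (L.F lam T (t + 1)).PosSemidef) (ht : t < T)
    (x : Fin n → ℝ) (u : Fin m → ℝ) :
    L.stageCost D lam mu t x u
        + ((L.A *ᵥ x + L.B *ᵥ u) ⬝ᵥ (L.F lam T (t + 1) *ᵥ (L.A *ᵥ x + L.B *ᵥ u))
          + L.S D lam mu T (t + 1) ⬝ᵥ (L.A *ᵥ x + L.B *ᵥ u))
      = x ⬝ᵥ (L.F lam T t *ᵥ x) + L.S D lam mu T t ⬝ᵥ x + L.costConst D lam mu T t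
        + (u - L.law D lam mu T t x) ⬝ᵥ
          (L.M (L.F lam T (t + 1)) *ᵥ (u - L.law D lam mu T t x)) := by
  have hsquare := riccatiStep_affine_complete_square hR hF (lam t) (L.S D lam mu T (t + 1)) x
    (g := (D.G t)ᵀ *ᵥ mu t) (l := L.offset D lam mu T t) rfl u
  have hlaw : u - L.law D lam mu T t x
      = u + L.K (L.F lam T (t + 1)) *ᵥ x - L.offset D lam mu T t := by
    rw [law]
    abel
  have hG : mu t ⬝ᵥ (D.G t *ᵥ u) = ((D.G t)ᵀ *ᵥ mu t) ⬝ᵥ u := by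
    rw [Matrix.mulVec_transpose, Matrix.dotProduct_mulVec]
  rw [F_eq_riccatiStep L lam ht, S_eq_linStep L D lam mu ht, hlaw, stageCost, costConst, linStep,
    dotProduct_add (mu t), hG, add_sub_assoc, add_dotProduct (∑ i, lam t i • D.c t i)]
  linarith

theorem sum_stageCost_add_eq (hR : L.R.PosDef) (hP : L.P.PosSemidef)
    (hQ : ∀ t < T, (L.Qlam (lam t)).PosSemidef) {x : ℕ → Fin n → ℝ} {u : ℕ → Fin m → ℝ}
    (hx : L.IsTrajectory t T x u) {r : ℕ} (htr : t ≤ r) (hrT : r ≤ T) :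
    ∑ k ∈ Finset.Ico t r, L.stageCost D lam mu k (x k) (u k)
        + (x r ⬝ᵥ (L.F lam T r *ᵥ x r) + L.S D lam mu T r ⬝ᵥ x r)
      = x t ⬝ᵥ (L.F lam T t *ᵥ x t) + L.S D lam mu T t ⬝ᵥ x t
        + ∑ k ∈ Finset.Ico t r, (L.costConst D lam mu T k
          + (u k - L.law D lam mu T k (x k)) ⬝ᵥ
            (L.M (L.F lam T (k + 1)) *ᵥ (u k - L.law D lam mu T k (x k)))) := by
  induction r, htr using Nat.le_induction with
  | base => simp
  | succ r htr ih =>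
    have hstage := stageCost_add_eq D mu hR (F_posSemidef hR hP hQ (r + 1)) hrT (x r) (u r)
    rw [← hx r htr hrT] at hstage
    rw [Finset.sum_Ico_succ_top htr, Finset.sum_Ico_succ_top htr]
    linarith [ih (by omega)]

theorem costToGo_eq (hR : L.R.PosDef) (hP : L.P.PosSemidef)
    (hQ : ∀ t < T, (L.Qlam (lam t)).PosSemidef) (ht : t ≤ T) {x : ℕ → Fin n → ℝ}
    {u : ℕ → Fin m → ℝ} (hx : L.IsTrajectory t T x u) :
    L.costToGo D lam mu T t x u = x t ⬝ᵥ (L.F lam T t *ᵥ x t) + L.S D lam mu T t ⬝ᵥ x t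
      + ∑ k ∈ Finset.Ico t T, (L.costConst D lam mu T k
        + (u k - L.law D lam mu T k (x k)) ⬝ᵥ
          (L.M (L.F lam T (k + 1)) *ᵥ (u k - L.law D lam mu T k (x k)))) := by
  rw [← sum_stageCost_add_eq D mu hR hP hQ hx ht le_rfl, F_self, S_self, zero_dotProduct,
    add_zero, costToGo, add_comm]

theorem costToGo_law_le (hR : L.R.PosDef) (hP : L.P.PosSemidef)
    (hQ : ∀ t < T, (L.Qlam (lam t)).PosSemidef) (ht : t ≤ T) {x y : ℕ → Fin n → ℝ}
    {u : ℕ → Fin m → ℝ} (hx : L.IsTrajectory t T x fun k => L.law D lam mu T k (x k))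
    (hy : L.IsTrajectory t T y u) (hxy : x t = y t) :
    L.costToGo D lam mu T t x (fun k => L.law D lam mu T k (x k)) ≤
      L.costToGo D lam mu T t y u := by
  rw [costToGo_eq D mu hR hP hQ ht hx, costToGo_eq D mu hR hP hQ ht hy, hxy]
  gcongr with k
  rw [sub_self, zero_dotProduct]
  exact dotProduct_mulVec_self_nonneg (M_posDef hR (F_posSemidef hR hP hQ _)).posSemidef _

end Recursion

end LQR

section LyapunovDecay

theorem lyapunov_contraction {θ β γ v w η : ℝ} (hθ : θ ≤ 1) (hβ : 0 ≤ β) (hγ : 0 ≤ γ)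
    (hv : v ≤ β * η) (hw : w ≤ γ * v + θ * η) :
    w ≤ (1 - (1 - θ) / (γ * β + 1)) * (γ * v + η) := by
  have hω : 0 < γ * β + 1 := by positivity
  have hη : (γ * v + η) / (γ * β + 1) ≤ η := by
    rw [div_le_iff₀ hω]
    linarith [mul_le_mul_of_nonneg_left hv hγ]
  have hgain := mul_le_mul_of_nonneg_left hη (sub_nonneg.2 hθ)
  rw [sub_mul, one_mul, div_mul_eq_mul_div, mul_div_assoc]
  linarith

theorem norm_le_of_lyapunov {E : Type*} [SeminormedAddCommGroup E] {z : ℕ → E} {W : ℕ → ℝ}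
    {ω ρ : ℝ} (hω : 0 ≤ ω) (hρ : 0 ≤ ρ) {r t : ℕ} (hrt : r ≤ t)
    (hW : ∀ k, r ≤ k → k < t → W (k + 1) ≤ ρ * W k) (hlower : ‖z t‖ ^ 2 ≤ W t)
    (hupper : W r ≤ ω * ‖z r‖ ^ 2) : ‖z t‖ ≤ √ω * √ρ ^ (t - r) * ‖z r‖ := by
  have hgeom : W t ≤ ρ ^ (t - r) * W r := by
    have h := le_geom (u := fun k => W (r + k)) hρ (t - r) fun k hk =>
      hW (r + k) (by omega) (by omega)
    rwa [Nat.add_sub_cancel' hrt] at h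
  refine (sq_le_sq₀ (norm_nonneg _) (by positivity)).1 ?_
  calc ‖z t‖ ^ 2 ≤ ρ ^ (t - r) * (ω * ‖z r‖ ^ 2) :=
        (hlower.trans hgeom).trans (by gcongr)
    _ = √ω ^ 2 * (√ρ ^ 2) ^ (t - r) * ‖z r‖ ^ 2 := by
        rw [Real.sq_sqrt hω, Real.sq_sqrt hρ]
        ring
    _ = (√ω * √ρ ^ (t - r) * ‖z r‖) ^ 2 := by ring

end LyapunovDecay

namespace LQR

variable {n m s : ℕ} {ι : Type*} [Fintype ι] {L : LQR n m ι} {lam : ℕ → ι → ℝ} {T : ℕ}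

theorem dotProduct_Fback_mulVec_le (hR : L.R.PosDef) (hP : L.P.PosSemidef)
    (hQ : ∀ t < T, (L.Qlam (lam t)).PosSemidef) {K₀ : Matrix (Fin m) (Fin n) ℝ}
    {N : Seminorm ℝ (Fin n → ℝ)} {θ b β : ℝ} (hβ : 0 ≤ β) (hβb : β * θ ^ 2 + b ≤ β)
    (hN : ∀ x, N ((L.A + L.B * K₀) *ᵥ x) ≤ θ * N x)
    (hstage : ∀ t < T, ∀ x,
      x ⬝ᵥ (L.Qlam (lam t) *ᵥ x) + (K₀ *ᵥ x) ⬝ᵥ (L.R *ᵥ (K₀ *ᵥ x)) ≤ b * N x ^ 2)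
    (hterminal : ∀ x, x ⬝ᵥ (L.P *ᵥ x) ≤ β * N x ^ 2) {k : ℕ} (hk : k ≤ T) (x : Fin n → ℝ) :
    x ⬝ᵥ (L.Fback lam T k *ᵥ x) ≤ β * N x ^ 2 := by
  induction k generalizing x with
  | zero => exact hterminal x
  | succ k ih =>
    have hnext : L.A *ᵥ x + L.B *ᵥ (K₀ *ᵥ x) = (L.A + L.B * K₀) *ᵥ x := by
      rw [Matrix.add_mulVec, Matrix.mulVec_mulVec]
    have hstep := dotProduct_riccatiStep_mulVec_le hR (Fback_posSemidef hR hP hQ k (by omega))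
      (lam (T - (k + 1))) x (K₀ *ᵥ x)
    rw [hnext] at hstep
    have hcontract : β * N ((L.A + L.B * K₀) *ᵥ x) ^ 2 ≤ β * (θ * N x) ^ 2 := by
      gcongr
      exact hN x
    have hβN : (β * θ ^ 2 + b) * N x ^ 2 ≤ β * N x ^ 2 := by gcongr
    rw [Fback]
    linarith [ih (by omega) ((L.A + L.B * K₀) *ᵥ x), hstage (T - (k + 1)) (by omega) x]

theorem exists_dotProduct_stage_le (hH : ∀ i, (L.H i).PosSemidef)
    (K₀ : Matrix (Fin m) (Fin n) ℝ) (Λ : ℝ) :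
    ∃ b : ℝ, 0 ≤ b ∧ ∀ lam : ι → ℝ, (∀ i, lam i ≤ Λ) → ∀ x,
      x ⬝ᵥ (L.Qlam lam *ᵥ x) + (K₀ *ᵥ x) ⬝ᵥ (L.R *ᵥ (K₀ *ᵥ x)) ≤ b * ‖x‖ ^ 2 := by
  obtain ⟨q, hq0, hq⟩ := exists_dotProduct_Qlam_mulVec_le hH Λ
  obtain ⟨c, hc0, hc⟩ := exists_dotProduct_mulVec_self_le (K₀ᵀ * L.R * K₀)
  refine ⟨q + c, add_nonneg hq0 hc0, fun lam hlam x => ?_⟩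
  rw [← dotProduct_transpose_mul_mul_mulVec, add_mul]
  exact add_le_add (hq lam hlam x) (hc x)

theorem Standing.exists_dotProduct_F_mulVec_le (hL : L.Standing) (Λ : ℝ) :
    ∃ β : ℝ, 0 ≤ β ∧ ∀ (T : ℕ) (lam : ℕ → ι → ℝ), (∀ t < T, ∀ i, 0 ≤ lam t i ∧ lam t i ≤ Λ) →
      ∀ t x, x ⬝ᵥ (L.F lam T t *ᵥ x) ≤ β * ‖x‖ ^ 2 := by
  obtain ⟨K₀, hK₀⟩ := hL.stabilizable
  obtain ⟨N, θ, hθ0, hθ1, hle, hN⟩ := hK₀.exists_seminorm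
  obtain ⟨a, ha, haN⟩ := exists_seminorm_le_mul_norm N
  obtain ⟨b, hb0, hb⟩ := exists_dotProduct_stage_le hL.posSemidef_H K₀ Λ
  obtain ⟨p, hp0, hp⟩ := exists_dotProduct_mulVec_self_le L.P
  have hθ2 : 0 < 1 - θ ^ 2 := sub_pos.2 (pow_lt_one₀ hθ0.le hθ1 two_ne_zero)
  -- `β` majorizes the terminal cost and solves `β θ² + b ≤ β`
  set β := p + b / (1 - θ ^ 2) with hβ
  have hβ0 : 0 ≤ β := by positivity
  have hpβ : p ≤ β := le_add_of_nonneg_right (by positivity)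
  have hβb : β * θ ^ 2 + b ≤ β := by
    have hb' : b / (1 - θ ^ 2) * (1 - θ ^ 2) = b := div_mul_cancel₀ b hθ2.ne'
    linarith [mul_nonneg hp0 hθ2.le, congrArg (· * (1 - θ ^ 2)) hβ]
  refine ⟨β * a ^ 2, by positivity, fun T lam hlam t x => ?_⟩
  have hFN : x ⬝ᵥ (L.F lam T t *ᵥ x) ≤ β * N x ^ 2 := by
    refine dotProduct_Fback_mulVec_le hL.posDef_R hL.posSemidef_P
      (fun t ht => Qlam_posSemidef hL.posSemidef_Q hL.posSemidef_H fun i => (hlam t ht i).1)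
      hβ0 hβb hN (fun t ht x => (hb _ (fun i => (hlam t ht i).2) x).trans ?_)
      (fun x => (hp x).trans ?_) (Nat.sub_le T t) x <;>
    · gcongr
      exact hle x
  calc x ⬝ᵥ (L.F lam T t *ᵥ x) ≤ β * (a * ‖x‖) ^ 2 := hFN.trans (by gcongr; exact haN x)
    _ = β * a ^ 2 * ‖x‖ ^ 2 := by ring

theorem lyapunov_closedLoop_le (hR : L.R.PosDef) {F : Matrix (Fin n) (Fin n) ℝ}
    (hF : F.PosSemidef) {lam : ι → ℝ} (hQ : L.Q ≤ L.Qlam lam) {N : Seminorm ℝ (Fin n → ℝ)}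
    {θ γ : ℝ} (hγ : 0 ≤ γ) (hN : ∀ x u, N (L.A *ᵥ x + L.B *ᵥ u) ^ 2 ≤
      θ * N x ^ 2 + γ * (x ⬝ᵥ (L.Q *ᵥ x) + u ⬝ᵥ (L.R *ᵥ u))) (x : Fin n → ℝ) :
    γ * ((L.closedLoop F *ᵥ x) ⬝ᵥ (F *ᵥ (L.closedLoop F *ᵥ x))) + N (L.closedLoop F *ᵥ x) ^ 2 ≤
      γ * (x ⬝ᵥ (L.riccatiStep lam F *ᵥ x)) + θ * N x ^ 2 := by
  have hobserver := hN x (-(L.K F *ᵥ x))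
  rw [← closedLoop_mulVec, Matrix.mulVec_neg, neg_dotProduct_neg] at hobserver
  rw [dotProduct_riccatiStep_mulVec_eq hR hF]
  linarith [mul_le_mul_of_nonneg_left (dotProduct_mulVec_self_mono hQ x) hγ]

theorem Standing.exists_closedLoop_decay (hL : L.Standing) (Λ : ℝ) :
    ∃ C α : ℝ, 0 < C ∧ 0 < α ∧ α < 1 ∧ ∀ (T : ℕ) (lam : ℕ → ι → ℝ),
      (∀ t < T, ∀ i, 0 ≤ lam t i ∧ lam t i ≤ Λ) → ∀ r t, r ≤ t → t ≤ T → ∀ z : ℕ → Fin n → ℝ,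
        (∀ k, r ≤ k → k < t → z (k + 1) = L.closedLoop (L.F lam T (k + 1)) *ᵥ z k) →
        ‖z t‖ ≤ C * α ^ (t - r) * ‖z r‖ := by
  obtain ⟨β, hβ0, hβ⟩ := hL.exists_dotProduct_F_mulVec_le Λ
  obtain ⟨N, θ, γ, hθ0, hθ1, hγ, hle, hN⟩ :=
    hL.detectable.exists_seminorm_sq_le_form hL.posSemidef_Q hL.posDef_R L.B
  obtain ⟨a, ha, haN⟩ := exists_seminorm_le_mul_norm N
  set ρ := 1 - (1 - θ) / (γ * β + 1) with hρ
  have hρ1 : ρ < 1 := sub_lt_self 1 (div_pos (sub_pos.2 hθ1) (by positivity))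
  have hρ0 : 0 < ρ := by
    rw [hρ, sub_pos, div_lt_one (by positivity)]
    linarith [mul_nonneg hγ hβ0]
  refine ⟨√(γ * β + a ^ 2), √ρ, by positivity, by positivity,
    (Real.sqrt_lt_sqrt hρ0.le hρ1).trans_eq Real.sqrt_one, fun T lam hlam r t hrt htT z hz => ?_⟩
  have hF : ∀ t, (L.F lam T t).PosSemidef := F_posSemidef hL.posDef_R hL.posSemidef_P
    fun t ht => Qlam_posSemidef hL.posSemidef_Q hL.posSemidef_H fun i => (hlam t ht i).1
  -- the Lyapunov function: the cost-to-go plus the norm in which the observer error contracts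
  refine norm_le_of_lyapunov (W := fun k => γ * (z k ⬝ᵥ (L.F lam T k *ᵥ z k)) + N (z k) ^ 2)
    (by positivity) hρ0.le hrt (fun k hrk hkt => ?_) ?_ ?_
  · have hFN : z k ⬝ᵥ (L.F lam T k *ᵥ z k) ≤ β * N (z k) ^ 2 :=
      (hβ T lam hlam k (z k)).trans (by gcongr; exact hle _)
    refine lyapunov_contraction hθ1.le hβ0 hγ hFN ?_
    rw [hz k hrk hkt, F_eq_riccatiStep L lam (by omega : k < T)]
    exact lyapunov_closedLoop_le hL.posDef_R (hF (k + 1))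
      (Q_le_Qlam hL.posSemidef_H fun i => (hlam k (by omega) i).1) hγ hN (z k)
  · refine le_add_of_nonneg_of_le (mul_nonneg hγ (dotProduct_mulVec_self_nonneg (hF t) _)) ?_
    gcongr
    exact hle _
  · calc γ * (z r ⬝ᵥ (L.F lam T r *ᵥ z r)) + N (z r) ^ 2
        ≤ γ * (β * ‖z r‖ ^ 2) + (a * ‖z r‖) ^ 2 := by
          gcongr
          · exact hβ T lam hlam r (z r)
          · exact haN _
      _ = (γ * β + a ^ 2) * ‖z r‖ ^ 2 := by ring

theorem mulVec_law (L : LQR n m ι) (D : AffineData n m s ι) (lam : ℕ → ι → ℝ)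
    (mu : ℕ → Fin s → ℝ) (T t : ℕ) (x : Fin n → ℝ) :
    L.A *ᵥ x + L.B *ᵥ L.law D lam mu T t x
      = L.closedLoop (L.F lam T (t + 1)) *ᵥ x + L.B *ᵥ L.offset D lam mu T t := by
  rw [law, Matrix.mulVec_add, closedLoop_mulVec, add_assoc]

theorem law_trajectory_sub_succ {D : AffineData n m s ι} {mu : ℕ → Fin s → ℝ} {r k : ℕ}
    {x y : ℕ → Fin n → ℝ} (hx : L.IsTrajectory r T x fun k => L.law D lam mu T k (x k))
    (hy : L.IsTrajectory r T y fun k => L.law D lam mu T k (y k)) (hrk : r ≤ k) (hkT : k < T) :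
    x (k + 1) - y (k + 1) = L.closedLoop (L.F lam T (k + 1)) *ᵥ (x k - y k) := by
  rw [hx k hrk hkT, hy k hrk hkT, mulVec_law, mulVec_law, Matrix.mulVec_sub,
    add_sub_add_right_eq_sub]

end LQR

section Convergence

theorem tendsto_zero_of_le_mul_add {u δ : ℕ → ℝ} {θ : ℝ} (hθ0 : 0 ≤ θ) (hθ1 : θ < 1)
    (hu : ∀ k, 0 ≤ u k) (hδ : Tendsto δ atTop (𝓝 0))
    (h : ∀ᶠ k in atTop, u (k + 1) ≤ θ * u k + δ k) : Tendsto u atTop (𝓝 0) := by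
  refine tendsto_order.2 ⟨fun b hb => Eventually.of_forall fun k => hb.trans_le (hu k),
    fun ε hε => ?_⟩
  have hδε : ∀ᶠ k in atTop, δ k < (1 - θ) * (ε / 2) :=
    hδ.eventually_lt_const (mul_pos (sub_pos.2 hθ1) (half_pos hε))
  obtain ⟨k₀, hk₀⟩ := eventually_atTop.1 (h.and hδε)
  have hgeom (j : ℕ) : u (k₀ + j) - ε / 2 ≤ θ ^ j * (u k₀ - ε / 2) :=
    le_geom (u := fun j => u (k₀ + j) - ε / 2) hθ0 j fun i _ => by
      have hstep := hk₀ (k₀ + i) (by omega)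
      rw [← add_assoc]
      linarith [hstep.1, hstep.2]
  have hlim : Tendsto (fun j => θ ^ j * (u k₀ - ε / 2)) atTop (𝓝 0) := by
    simpa using (tendsto_pow_atTop_nhds_zero_of_lt_one hθ0 hθ1).mul_const (u k₀ - ε / 2)
  rw [← map_add_atTop_eq_nat k₀, eventually_map]
  filter_upwards [hlim.eventually_lt_const (half_pos hε)] with j hj
  rw [add_comm]
  linarith [hgeom j]

variable {p q : Type*}

theorem tendsto_mulVec [Fintype q] {X : Type*} {l : Filter X} {A : X → Matrix p q ℝ}
    {x : X → q → ℝ} {A₀ : Matrix p q ℝ} {x₀ : q → ℝ} (hA : Tendsto A l (𝓝 A₀))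
    (hx : Tendsto x l (𝓝 x₀)) : Tendsto (fun b => A b *ᵥ x b) l (𝓝 (A₀ *ᵥ x₀)) :=
  ((continuous_fst.matrix_mulVec continuous_snd).tendsto (A₀, x₀)).comp (hA.prodMk_nhds hx)

theorem eventually_seminorm_mulVec_le [Fintype p] {N : Seminorm ℝ (p → ℝ)} {θ θ' : ℝ}
    (hθ : θ < θ') (hle : ∀ x, ‖x‖ ≤ N x) {A : Matrix p p ℝ} (hA : ∀ x, N (A *ᵥ x) ≤ θ * N x)
    {X : Type*} {l : Filter X} {A' : X → Matrix p p ℝ} (hA' : Tendsto A' l (𝓝 A)) :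
    ∀ᶠ b in l, ∀ x, N (A' b *ᵥ x) ≤ θ' * N x := by
  classical
  obtain ⟨a, ha, haN⟩ := exists_seminorm_le_mul_norm N
  let Φ : Matrix p p ℝ →ₗ[ℝ] (p → ℝ) →L[ℝ] p → ℝ :=
    LinearMap.toContinuousLinearMap.toLinearMap ∘ₗ Matrix.toLin'.toLinearMap
  have hΦ : Tendsto (fun b => a * ‖Φ (A' b - A)‖) l (𝓝 0) := by
    have hcont : Continuous Φ := Φ.continuous_of_finiteDimensional
    simpa using (((hcont.tendsto _).comp (hA'.sub_const A)).norm).const_mul a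
  filter_upwards [hΦ.eventually_lt_const (sub_pos.2 hθ)] with b hb x
  calc N (A' b *ᵥ x) = N (A *ᵥ x + Φ (A' b - A) x) := by
        simp [Φ]
    _ ≤ N (A *ᵥ x) + N (Φ (A' b - A) x) := map_add_le_add N _ _
    _ ≤ θ * N x + a * (‖Φ (A' b - A)‖ * N x) := by
        gcongr
        · exact hA x
        · refine (haN _).trans ?_
          gcongr
          exact ((Φ (A' b - A)).le_opNorm x).trans (by gcongr; exact hle x)
    _ ≤ θ' * N x := by linarith [mul_le_mul_of_nonneg_right hb.le (apply_nonneg N x)]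

theorem SchurStable.exists_tendsto_affine_iterate {n : ℕ} {A : Matrix (Fin n) (Fin n) ℝ}
    (hA : SchurStable A) {A' : ℕ → Matrix (Fin n) (Fin n) ℝ} (hA' : Tendsto A' atTop (𝓝 A))
    {w : Fin n → ℝ} {w' : ℕ → Fin n → ℝ} (hw' : Tendsto w' atTop (𝓝 w)) {v : ℕ → Fin n → ℝ}
    (hv : ∀ k, v (k + 1) = A' k *ᵥ v k + w' k) : ∃ v₀, Tendsto v atTop (𝓝 v₀) := by
  obtain ⟨v₀, hv₀⟩ := hA.exists_eq_mulVec_add w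
  obtain ⟨N, θ, hθ0, hθ1, hle, hN⟩ := hA.exists_seminorm
  obtain ⟨a, -, haN⟩ := exists_seminorm_le_mul_norm N
  obtain ⟨θ', hθθ', hθ'1⟩ := exists_between hθ1
  have hδ : Tendsto (fun k => a * ‖A' k *ᵥ v₀ + w' k - v₀‖) atTop (𝓝 0) := by
    have hdefect := ((tendsto_mulVec hA' (tendsto_const_nhds (x := v₀))).add hw').sub_const v₀
    rw [← hv₀, sub_self] at hdefect
    simpa using hdefect.norm.const_mul a
  have hlim : Tendsto (fun k => N (v k - v₀)) atTop (𝓝 0) := by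
    refine tendsto_zero_of_le_mul_add (hθ0.trans hθθ').le hθ'1 (fun k => apply_nonneg N _) hδ ?_
    filter_upwards [eventually_seminorm_mulVec_le hθθ' hle hN hA'] with k hk
    calc N (v (k + 1) - v₀) = N (A' k *ᵥ (v k - v₀) + (A' k *ᵥ v₀ + w' k - v₀)) := by
          rw [hv, Matrix.mulVec_sub]
          congr 1
          abel
      _ ≤ N (A' k *ᵥ (v k - v₀)) + N (A' k *ᵥ v₀ + w' k - v₀) := map_add_le_add N _ _
      _ ≤ θ' * N (v k - v₀) + a * ‖A' k *ᵥ v₀ + w' k - v₀‖ := add_le_add (hk _) (haN _)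
  exact ⟨v₀, tendsto_iff_norm_sub_tendsto_zero.2
    (squeeze_zero (fun k => norm_nonneg _) (fun k => hle _) hlim)⟩

theorem isClosed_setOf_posSemidef [Finite p] :
    IsClosed {X : Matrix p p ℝ | X.PosSemidef} := by
  cases nonempty_fintype p
  simp only [Matrix.posSemidef_iff_dotProduct_mulVec, Set.ofPred_and, Set.ofPred_forall]
  refine (isClosed_eq continuous_id.matrix_conjTranspose continuous_id).inter
    (isClosed_iInter fun x => isClosed_le continuous_const ?_)
  fun_prop

theorem exists_abs_transpose_mul_mul_apply_le [Fintype p] [Fintype q] (X : Matrix p p ℝ) :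
    ∃ c : ℝ, ∀ (Y Z : Matrix p q ℝ) (g : ℝ), 0 ≤ g → (∀ x, ‖Y *ᵥ x‖ ≤ g * ‖x‖) →
      (∀ x, ‖Z *ᵥ x‖ ≤ g * ‖x‖) → ∀ i j, |(Yᵀ * X * Z) i j| ≤ c * g ^ 2 := by
  classical
  obtain ⟨c, hc0, hc⟩ := exists_abs_dotProduct_mulVec_le X
  refine ⟨c, fun Y Z g hg hY hZ i j => ?_⟩
  have hentry : (Yᵀ * X * Z) i j = (Y *ᵥ Pi.single i 1) ⬝ᵥ (X *ᵥ (Z *ᵥ Pi.single j 1)) := by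
    rw [← dotProduct_transpose_mul_mul_mulVec, Matrix.mulVec_single_one,
      single_one_dotProduct, Matrix.col_apply]
  have hsingle (i : q) : g * ‖(Pi.single i 1 : q → ℝ)‖ = g := by
    rw [Pi.norm_single, norm_one, mul_one]
  rw [hentry, sq]
  refine (hc _ _).trans ?_
  gcongr
  · exact (hY _).trans_eq (hsingle i)
  · exact (hZ _).trans_eq (hsingle j)

theorem exists_tendsto_of_abs_sub_apply_le_geometric {X : ℕ → Matrix p q ℝ}
    {c ρ : ℝ} (hρ : ρ < 1) (h : ∀ k i j, |X (k + 1) i j - X k i j| ≤ c * ρ ^ k) :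
    ∃ Y, Tendsto X atTop (𝓝 Y) := by
  have hentry (i : p) (j : q) : ∃ y, Tendsto (fun k => X k i j) atTop (𝓝 y) := by
    refine cauchySeq_tendsto_of_complete (cauchySeq_of_le_geometric ρ c hρ fun k => ?_)
    rw [dist_comm, Real.dist_eq]
    exact h k i j
  choose Y hY using hentry
  exact ⟨Matrix.of Y, tendsto_pi_nhds.2 fun i => tendsto_pi_nhds.2 (hY i)⟩

end Convergence

namespace LQR

section GainContinuity

variable {n m : ℕ} {ι : Type*} {L : LQR n m ι} {F : Matrix (Fin n) (Fin n) ℝ}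

theorem continuousAt_M_inv (hR : L.R.PosDef) (hF : F.PosSemidef) :
    ContinuousAt (fun F => (L.M F)⁻¹) F := by
  have hM : Continuous L.M := by
    unfold M
    fun_prop
  have hdet : ContinuousAt Ring.inverse (L.M F).det := by
    rw [Ring.inverse_eq_inv']
    exact continuousAt_inv₀ (isUnit_det_M hR hF).ne_zero
  exact ContinuousAt.comp (f := L.M) (continuousAt_matrix_inv (L.M F) hdet) hM.continuousAt

theorem continuousAt_K (hR : L.R.PosDef) (hF : F.PosSemidef) : ContinuousAt L.K F := by
  have hcont : Continuous fun q : Matrix (Fin m) (Fin m) ℝ × Matrix (Fin n) (Fin n) ℝ =>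
      q.1 * L.Bᵀ * q.2 * L.A := by
    fun_prop
  exact ContinuousAt.comp (f := fun F => ((L.M F)⁻¹, F)) hcont.continuousAt
    ((continuousAt_M_inv hR hF).prodMk continuousAt_id)

theorem continuousAt_closedLoop (hR : L.R.PosDef) (hF : F.PosSemidef) :
    ContinuousAt L.closedLoop F := by
  have hcont : Continuous fun K : Matrix (Fin m) (Fin n) ℝ => L.A - L.B * K := by
    fun_prop
  exact hcont.continuousAt.comp (continuousAt_K hR hF)

theorem exists_equilibrium_of_norm_closedLoop_pow_le {C α : ℝ}
    (hstable : SchurStable (L.closedLoop F))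
    (hpow : ∀ t x, ‖L.closedLoop F ^ t *ᵥ x‖ ≤ C * α ^ t * ‖x‖) (l : Fin m → ℝ) :
    ∃ xbar, xbar = L.A *ᵥ xbar + L.B *ᵥ (-(L.K F *ᵥ xbar) + l) ∧ ∀ x : ℕ → Fin n → ℝ,
      (∀ t, x (t + 1) = L.A *ᵥ x t + L.B *ᵥ (-(L.K F *ᵥ x t) + l)) →
      ∀ t, ‖x t - xbar‖ ≤ C * α ^ t * ‖x 0 - xbar‖ := by
  obtain ⟨xbar, hxbar⟩ := hstable.exists_eq_mulVec_add (L.B *ᵥ l)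
  simp only [Matrix.mulVec_add L.B, ← add_assoc, ← closedLoop_mulVec]
  refine ⟨xbar, hxbar, fun x hx t => ?_⟩
  rw [sub_eq_pow_mulVec_sub hxbar hx]
  exact hpow t _

end GainContinuity

section Transport

variable {n m : ℕ} {ι : Type*} [Fintype ι] {L : LQR n m ι}

theorem riccatiStep_sub_riccatiStep (hR : L.R.PosDef) {F₁ F₂ : Matrix (Fin n) (Fin n) ℝ}
    (h₁ : F₁.PosSemidef) (h₂ : F₂.PosSemidef) (lam : ι → ℝ) :
    L.riccatiStep lam F₁ - L.riccatiStep lam F₂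
      = (L.closedLoop F₁)ᵀ * (F₁ - F₂) * L.closedLoop F₂ := by
  have hK₁ : (L.K F₁)ᵀ * (L.Bᵀ * F₁ * L.B) = L.Aᵀ * F₁ * L.B - (L.K F₁)ᵀ * L.R := by
    rw [← K_transpose_mul_M hR h₁, M, Matrix.mul_add, add_sub_cancel_right]
  have hK₂ : L.Bᵀ * F₂ * L.B * L.K F₂ = L.Bᵀ * F₂ * L.A - L.R * L.K F₂ := by
    rw [← M_mul_K hR h₂, M, Matrix.add_mul, add_sub_cancel_right]
  have hA₁ : (L.K F₁)ᵀ * L.M F₁ * L.K F₁ = (L.K F₁)ᵀ * (L.Bᵀ * F₁ * L.A) := by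
    rw [Matrix.mul_assoc, M_mul_K hR h₁]
  have hA₂ : (L.K F₂)ᵀ * L.M F₂ * L.K F₂ = L.Aᵀ * F₂ * L.B * L.K F₂ := by
    rw [K_transpose_mul_M hR h₂]
  rw [riccatiStep_eq_sub hR h₁, riccatiStep_eq_sub hR h₂, hA₁, hA₂, closedLoop, closedLoop,
    Matrix.transpose_sub, Matrix.transpose_mul]
  have hK₁' := congrArg (· * L.K F₂) hK₁
  have hK₂' := congrArg ((L.K F₁)ᵀ * ·) hK₂
  simp only [Matrix.sub_mul, Matrix.mul_sub, Matrix.mul_assoc] at hK₁' hK₂' ⊢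
  rw [hK₁', hK₂']
  abel

/-- The transition matrix from time `0` to time `t` of the homogeneous closed loop for the
horizon `T` (meaningful for `t ≤ T`). -/
noncomputable def transition (L : LQR n m ι) (lam : ℕ → ι → ℝ) (T : ℕ) :
    ℕ → Matrix (Fin n) (Fin n) ℝ
  | 0 => 1
  | t + 1 => L.closedLoop (L.F lam T (t + 1)) * transition L lam T t

theorem transition_zero_mulVec (L : LQR n m ι) (lam : ℕ → ι → ℝ) (T : ℕ) (x : Fin n → ℝ) :
    L.transition lam T 0 *ᵥ x = x :=
  Matrix.one_mulVec x

theorem transition_succ_mulVec (L : LQR n m ι) (lam : ℕ → ι → ℝ) (T t : ℕ) (x : Fin n → ℝ) :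
    L.transition lam T (t + 1) *ᵥ x
      = L.closedLoop (L.F lam T (t + 1)) *ᵥ (L.transition lam T t *ᵥ x) :=
  (Matrix.mulVec_mulVec _ _ _).symm

theorem transition_transpose_mul_F_sub_mul_transition (hR : L.R.PosDef) {lam : ℕ → ι → ℝ}
    {T₁ T₂ : ℕ} (hF₁ : ∀ t, (L.F lam T₁ t).PosSemidef) (hF₂ : ∀ t, (L.F lam T₂ t).PosSemidef)
    {t : ℕ} (ht₁ : t ≤ T₁) (ht₂ : t ≤ T₂) :
    (L.transition lam T₁ t)ᵀ * (L.F lam T₁ t - L.F lam T₂ t) * L.transition lam T₂ t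
      = L.F lam T₁ 0 - L.F lam T₂ 0 := by
  induction t with
  | zero => simp [transition]
  | succ t ih =>
    rw [← ih (by omega) (by omega), F_eq_riccatiStep L lam ht₁, F_eq_riccatiStep L lam ht₂,
      riccatiStep_sub_riccatiStep hR (hF₁ _) (hF₂ _), transition, transition,
      Matrix.transpose_mul]
    simp only [Matrix.mul_assoc]

end Transport

section Stationary

variable {n m s : ℕ} {ι : Type*} [Fintype ι] {L : LQR n m ι} {D : AffineData n m s ι}
  {lam : ℕ → ι → ℝ} {mu : ℕ → Fin s → ℝ}

theorem Fback_eq_of_stationary (hlam : ∀ t, lam t = lam 0) (T₁ T₂ k : ℕ) :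
    L.Fback lam T₁ k = L.Fback lam T₂ k := by
  induction k with
  | zero => rfl
  | succ k ih => rw [Fback, Fback, ih, hlam, hlam (T₂ - _)]

theorem F_eq_F_sub_zero (hlam : ∀ t, lam t = lam 0) (T t : ℕ) :
    L.F lam T t = L.F lam (T - t) 0 :=
  Fback_eq_of_stationary hlam T (T - t) (T - t)

theorem Sback_eq_of_stationary (hc : ∀ t, D.c t = D.c 0) (hG : ∀ t, D.G t = D.G 0)
    (hlam : ∀ t, lam t = lam 0) (hmu : ∀ t, mu t = mu 0) (T₁ T₂ k : ℕ) :
    L.Sback D lam mu T₁ k = L.Sback D lam mu T₂ k := by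
  induction k with
  | zero => rfl
  | succ k ih =>
    rw [Sback, Sback, ih, Fback_eq_of_stationary hlam T₁ T₂]
    simp only [linStep, hlam (_ - _), hc (_ - _), hG (_ - _), hmu (_ - _)]

theorem S_eq_S_sub_zero (hc : ∀ t, D.c t = D.c 0) (hG : ∀ t, D.G t = D.G 0)
    (hlam : ∀ t, lam t = lam 0) (hmu : ∀ t, mu t = mu 0) (T t : ℕ) :
    L.S D lam mu T t = L.S D lam mu (T - t) 0 :=
  Sback_eq_of_stationary hc hG hlam hmu T (T - t) (T - t)

theorem linStep_eq_closedLoop (L : LQR n m ι) (D : AffineData n m s ι) (lam : ℕ → ι → ℝ)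
    (mu : ℕ → Fin s → ℝ) (t : ℕ) (F : Matrix (Fin n) (Fin n) ℝ) (S : Fin n → ℝ) :
    L.linStep D lam mu t F S = (L.closedLoop F)ᵀ *ᵥ S
      + (∑ i, lam t i • D.c t i - (L.K F)ᵀ *ᵥ ((D.G t)ᵀ *ᵥ mu t)) := by
  rw [linStep, closedLoop, Matrix.transpose_sub, Matrix.transpose_mul, Matrix.sub_mulVec,
    Matrix.mulVec_add, ← Matrix.mulVec_mulVec]
  abel

variable {C α : ℝ} {Finf : Matrix (Fin n) (Fin n) ℝ}

theorem exists_tendsto_F (hR : L.R.PosDef) (hlam : ∀ t, lam t = lam 0)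
    (hF : ∀ T t, (L.F lam T t).PosSemidef) (hC : 0 ≤ C) (hα0 : 0 ≤ α) (hα1 : α < 1)
    (hdecay : ∀ T t, t ≤ T → ∀ x, ‖L.transition lam T t *ᵥ x‖ ≤ C * α ^ t * ‖x‖) :
    ∃ Finf, Finf.PosSemidef ∧ ∀ t, Tendsto (fun T => L.F lam T t) atTop (𝓝 Finf) := by
  obtain ⟨c, hc⟩ := exists_abs_transpose_mul_mul_apply_le (q := Fin n) (L.F lam 1 0 - L.P)
  have hdiff (T : ℕ) : L.F lam (T + 1) 0 - L.F lam T 0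
      = (L.transition lam (T + 1) T)ᵀ * (L.F lam 1 0 - L.P) * L.transition lam T T := by
    rw [← transition_transpose_mul_F_sub_mul_transition hR (hF _) (hF _) (Nat.le_succ T) le_rfl,
      F_self, F_eq_F_sub_zero hlam (T + 1), Nat.add_sub_cancel_left]
  obtain ⟨Finf, hFinf⟩ : ∃ Finf, Tendsto (fun T => L.F lam T 0) atTop (𝓝 Finf) := by
    refine exists_tendsto_of_abs_sub_apply_le_geometric (c := c * C ^ 2)
      (pow_lt_one₀ hα0 hα1 two_ne_zero) fun T i j => ?_
    calc |L.F lam (T + 1) 0 i j - L.F lam T 0 i j| ≤ c * (C * α ^ T) ^ 2 := by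
          rw [← Matrix.sub_apply, hdiff]
          exact hc _ _ _ (by positivity) (hdecay (T + 1) T (Nat.le_succ T)) (hdecay T T le_rfl) i j
      _ = c * C ^ 2 * (α ^ 2) ^ T := by ring
  refine ⟨Finf, isClosed_setOf_posSemidef.mem_of_tendsto hFinf
    (Eventually.of_forall fun T => hF T 0), fun t => ?_⟩
  simp only [F_eq_F_sub_zero hlam _ t]
  exact hFinf.comp (tendsto_sub_atTop_nat t)

theorem tendsto_transition (hR : L.R.PosDef) (hFinf : Finf.PosSemidef)
    (hF : ∀ t, Tendsto (fun T => L.F lam T t) atTop (𝓝 Finf)) (t : ℕ) :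
    Tendsto (fun T => L.transition lam T t) atTop (𝓝 (L.closedLoop Finf ^ t)) := by
  induction t with
  | zero => exact tendsto_const_nhds
  | succ t ih =>
    rw [pow_succ']
    exact ((continuousAt_closedLoop hR hFinf).tendsto.comp (hF (t + 1))).mul ih

theorem norm_closedLoop_pow_mulVec_le (hR : L.R.PosDef) (hFinf : Finf.PosSemidef)
    (hF : ∀ t, Tendsto (fun T => L.F lam T t) atTop (𝓝 Finf))
    (hdecay : ∀ T t, t ≤ T → ∀ x, ‖L.transition lam T t *ᵥ x‖ ≤ C * α ^ t * ‖x‖)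
    (t : ℕ) (x : Fin n → ℝ) : ‖L.closedLoop Finf ^ t *ᵥ x‖ ≤ C * α ^ t * ‖x‖ :=
  le_of_tendsto (tendsto_mulVec (tendsto_transition hR hFinf hF t) tendsto_const_nhds).norm
    ((eventually_ge_atTop t).mono fun T hT => hdecay T t hT x)

theorem exists_tendsto_S (hR : L.R.PosDef) (hc : ∀ t, D.c t = D.c 0) (hG : ∀ t, D.G t = D.G 0)
    (hlam : ∀ t, lam t = lam 0) (hmu : ∀ t, mu t = mu 0) (hFinf : Finf.PosSemidef)
    (hF : ∀ t, Tendsto (fun T => L.F lam T t) atTop (𝓝 Finf))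
    (hstable : SchurStable (L.closedLoop Finf)) :
    ∃ Sinf, ∀ t, Tendsto (fun T => L.S D lam mu T t) atTop (𝓝 Sinf) := by
  have hrec (T : ℕ) : L.S D lam mu (T + 1) 0 = (L.closedLoop (L.F lam T 0))ᵀ *ᵥ L.S D lam mu T 0
      + (∑ i, lam 0 i • D.c 0 i - (L.K (L.F lam T 0))ᵀ *ᵥ ((D.G 0)ᵀ *ᵥ mu 0)) := by
    rw [S_eq_linStep L D lam mu T.succ_pos, linStep_eq_closedLoop, F_eq_F_sub_zero hlam (T + 1),
      S_eq_S_sub_zero hc hG hlam hmu (T + 1), zero_add, Nat.add_sub_cancel]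
  have hA : Tendsto (fun T => (L.closedLoop (L.F lam T 0))ᵀ) atTop (𝓝 (L.closedLoop Finf)ᵀ) :=
    (continuous_id.matrix_transpose.tendsto _).comp
      ((continuousAt_closedLoop hR hFinf).tendsto.comp (hF 0))
  have hK : Tendsto (fun T => (L.K (L.F lam T 0))ᵀ) atTop (𝓝 (L.K Finf)ᵀ) :=
    (continuous_id.matrix_transpose.tendsto _).comp
      ((continuousAt_K hR hFinf).tendsto.comp (hF 0))
  obtain ⟨Sinf, hS⟩ := hstable.transpose.exists_tendsto_affine_iterate
    (v := fun T => L.S D lam mu T 0) hA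
    ((tendsto_mulVec hK tendsto_const_nhds).const_sub _) hrec
  refine ⟨Sinf, fun t => ?_⟩
  simp only [S_eq_S_sub_zero hc hG hlam hmu _ t]
  exact hS.comp (tendsto_sub_atTop_nat t)

theorem tendsto_offset (hR : L.R.PosDef) (hG : ∀ t, D.G t = D.G 0) (hmu : ∀ t, mu t = mu 0)
    (hFinf : Finf.PosSemidef) {t : ℕ}
    (hF : Tendsto (fun T => L.F lam T (t + 1)) atTop (𝓝 Finf)) {Sinf : Fin n → ℝ}
    (hS : Tendsto (fun T => L.S D lam mu T (t + 1)) atTop (𝓝 Sinf)) :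
    Tendsto (fun T => L.offset D lam mu T t) atTop
      (𝓝 (-((1 / 2 : ℝ) • ((L.M Finf)⁻¹ *ᵥ (L.Bᵀ *ᵥ Sinf + (D.G 0)ᵀ *ᵥ mu 0))))) := by
  simp only [offset, hG t, hmu t]
  exact ((tendsto_mulVec ((continuousAt_M_inv hR hFinf).tendsto.comp hF)
    ((tendsto_mulVec tendsto_const_nhds hS).add_const _)).const_smul _).neg

theorem exists_stationary_law (hR : L.R.PosDef) (hF : ∀ T t, (L.F lam T t).PosSemidef)
    (hc : ∀ t, D.c t = D.c 0) (hG : ∀ t, D.G t = D.G 0) (hlam : ∀ t, lam t = lam 0)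
    (hmu : ∀ t, mu t = mu 0) (hC : 0 ≤ C) (hα0 : 0 ≤ α) (hα1 : α < 1)
    (hdecay : ∀ T t, t ≤ T → ∀ x, ‖L.transition lam T t *ᵥ x‖ ≤ C * α ^ t * ‖x‖) :
    ∃ (Kinf : Matrix (Fin m) (Fin n) ℝ) (linf : Fin m → ℝ) (xbar : Fin n → ℝ),
      (∀ t, Tendsto (fun T => L.K (L.F lam T (t + 1))) atTop (𝓝 Kinf)) ∧
      (∀ t, Tendsto (fun T => L.offset D lam mu T t) atTop (𝓝 linf)) ∧
      SchurStable (L.A - L.B * Kinf) ∧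
      xbar = L.A *ᵥ xbar + L.B *ᵥ (-(Kinf *ᵥ xbar) + linf) ∧
      ∀ x : ℕ → Fin n → ℝ,
        (∀ t, x (t + 1) = L.A *ᵥ x t + L.B *ᵥ (-(Kinf *ᵥ x t) + linf)) →
        ∀ t, ‖x t - xbar‖ ≤ C * α ^ t * ‖x 0 - xbar‖ := by
  obtain ⟨Finf, hFinf, hFlim⟩ := exists_tendsto_F hR hlam hF hC hα0 hα1 hdecay
  have hpow := norm_closedLoop_pow_mulVec_le hR hFinf hFlim hdecay
  have hstable : SchurStable (L.closedLoop Finf) := .of_norm_pow_mulVec_le hC hα0 hα1 hpow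
  obtain ⟨Sinf, hS⟩ := exists_tendsto_S hR hc hG hlam hmu hFinf hFlim hstable
  obtain ⟨xbar, hxbar, hx⟩ := exists_equilibrium_of_norm_closedLoop_pow_le hstable hpow
    (-((1 / 2 : ℝ) • ((L.M Finf)⁻¹ *ᵥ (L.Bᵀ *ᵥ Sinf + (D.G 0)ᵀ *ᵥ mu 0))))
  exact ⟨L.K Finf, _, xbar,
    fun t => (continuousAt_K hR hFinf).tendsto.comp (hFlim (t + 1)),
    fun t => tendsto_offset hR hG hmu hFinf (hFlim (t + 1)) (hS (t + 1)), hstable, hxbar, hx⟩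

end Stationary

end LQR

theorem theorem2_general {n m : ℕ} {ι : Type*} [Fintype ι] (L : LQR n m ι) (hL : L.Standing) :
    (∀ lam : ι → ℝ, (∀ i, 0 ≤ lam i) → Detectable L.A (CFC.sqrt (L.Qlam lam))) ∧
    (∀ (s : ℕ) (D : AffineData n m s ι) (T : ℕ) (lam : ℕ → ι → ℝ) (mu : ℕ → Fin s → ℝ),
      (∀ t < T, ∀ i, 0 ≤ lam t i) →
      ∀ t ≤ T, ∀ (x y : ℕ → Fin n → ℝ) (u : ℕ → Fin m → ℝ),
        L.IsTrajectory t T y u →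
        L.IsTrajectory t T x (fun k => L.law D lam mu T k (x k)) → x t = y t →
        L.costToGo D lam mu T t x (fun k => L.law D lam mu T k (x k)) ≤
          L.costToGo D lam mu T t y u) ∧
    (∀ Λ : ℝ, ∃ C α : ℝ, 0 < C ∧ 0 < α ∧ α < 1 ∧
      (∀ (s : ℕ) (D : AffineData n m s ι) (T : ℕ) (lam : ℕ → ι → ℝ) (mu : ℕ → Fin s → ℝ),
        (∀ t < T, ∀ i, 0 ≤ lam t i ∧ lam t i ≤ Λ) →
        ∀ r t : ℕ, r ≤ t → t ≤ T → ∀ x y : ℕ → Fin n → ℝ,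
          L.IsTrajectory r T x (fun k => L.law D lam mu T k (x k)) →
          L.IsTrajectory r T y (fun k => L.law D lam mu T k (y k)) →
          ‖x t - y t‖ ≤ C * α ^ (t - r) * ‖x r - y r‖) ∧
      (∀ (s : ℕ) (D : AffineData n m s ι) (lam : ℕ → ι → ℝ) (mu : ℕ → Fin s → ℝ),
        (∀ t, D.c t = D.c 0) → (∀ t, D.G t = D.G 0) →
        (∀ t, lam t = lam 0) → (∀ t, mu t = mu 0) →
        (∀ i, 0 ≤ lam 0 i ∧ lam 0 i ≤ Λ) →
        ∃ (Kinf : Matrix (Fin m) (Fin n) ℝ) (linf : Fin m → ℝ) (xbar : Fin n → ℝ),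
          (∀ t, Tendsto (fun T => L.K (L.F lam T (t + 1))) atTop (𝓝 Kinf)) ∧
          (∀ t, Tendsto (fun T => L.offset D lam mu T t) atTop (𝓝 linf)) ∧
          SchurStable (L.A - L.B * Kinf) ∧
          xbar = L.A *ᵥ xbar + L.B *ᵥ (-(Kinf *ᵥ xbar) + linf) ∧
          ∀ x : ℕ → Fin n → ℝ,
            (∀ t, x (t + 1) = L.A *ᵥ x t + L.B *ᵥ (-(Kinf *ᵥ x t) + linf)) →
            ∀ t, ‖x t - xbar‖ ≤ C * α ^ t * ‖x 0 - xbar‖)) := by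
  have hQ {T : ℕ} {lam : ℕ → ι → ℝ} (hlam : ∀ t < T, ∀ i, 0 ≤ lam t i) :
      ∀ t < T, (L.Qlam (lam t)).PosSemidef := fun t ht =>
    LQR.Qlam_posSemidef hL.posSemidef_Q hL.posSemidef_H (hlam t ht)
  refine ⟨fun lam hlam => hL.detectable_sqrt_Qlam hlam,
    fun s D T lam mu hlam t ht x y u hy hx hxy => LQR.costToGo_law_le D mu hL.posDef_R
      hL.posSemidef_P (hQ hlam) ht hx hy hxy, fun Λ => ?_⟩
  obtain ⟨C, α, hC, hα0, hα1, hdecay⟩ := hL.exists_closedLoop_decay Λ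
  refine ⟨C, α, hC, hα0, hα1, fun s D T lam mu hlam r t hrt htT x y hx hy => ?_,
    fun s D lam mu hc hG hlam hmu hΛ => ?_⟩
  · exact hdecay T lam hlam r t hrt htT (fun k => x k - y k) fun k hrk hkt =>
      LQR.law_trajectory_sub_succ hx hy hrk (hkt.trans_le htT)
  · have hlamΛ (t : ℕ) (i : ι) : 0 ≤ lam t i ∧ lam t i ≤ Λ := hlam t ▸ hΛ i
    have htransition (T t : ℕ) (htT : t ≤ T) (x : Fin n → ℝ) :
        ‖L.transition lam T t *ᵥ x‖ ≤ C * α ^ t * ‖x‖ := by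
      simpa only [LQR.transition_zero_mulVec, Nat.sub_zero] using
        hdecay T lam (fun t _ => hlamΛ t) 0 t t.zero_le htT (fun k => L.transition lam T k *ᵥ x)
          fun k _ _ => LQR.transition_succ_mulVec L lam T k x
    exact LQR.exists_stationary_law hL.posDef_R
      (fun T => LQR.F_posSemidef hL.posDef_R hL.posSemidef_P (hQ fun t _ i => (hlamΛ t i).1))
      hc hG hlam hmu hC.le hα0.le hα1 htransition

theorem theorem2 {n m : ℕ} {ι : Type*} [Fintype ι] (L : LQR n m ι) (hL : L.Standing) :
    -- detectability is kept by every nonnegative multiplier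
    (∀ lam : ι → ℝ, (∀ i, 0 ≤ lam i) → Detectable L.A (CFC.sqrt (L.Qlam lam))) ∧
    -- the law attains the minimum of the cost-to-go, from every time and state
    (∀ (s : ℕ) (D : AffineData n m s ι) (T : ℕ) (lam : ℕ → ι → ℝ) (mu : ℕ → Fin s → ℝ),
      (∀ t < T, ∀ i, 0 ≤ lam t i) → (∀ t < T, ∀ j, 0 ≤ mu t j) →
      ∀ t ≤ T, ∀ (x y : ℕ → Fin n → ℝ) (u : ℕ → Fin m → ℝ),
        L.IsTrajectory t T y u →
        L.IsTrajectory t T x (fun k => L.law D lam mu T k (x k)) → x t = y t →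
        L.costToGo D lam mu T t x (fun k => L.law D lam mu T k (x k)) ≤
          L.costToGo D lam mu T t y u) ∧
    -- the law stabilizes the system, uniformly in the horizon
    (∀ Λ : ℝ, ∃ C α : ℝ, 0 < C ∧ 0 < α ∧ α < 1 ∧
      (∀ (s : ℕ) (D : AffineData n m s ι) (T : ℕ) (lam : ℕ → ι → ℝ) (mu : ℕ → Fin s → ℝ),
        (∀ t < T, ∀ i, 0 ≤ lam t i ∧ lam t i ≤ Λ) → (∀ t < T, ∀ j, 0 ≤ mu t j) →
        ∀ r t : ℕ, r ≤ t → t ≤ T → ∀ x y : ℕ → Fin n → ℝ,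
          L.IsTrajectory r T x (fun k => L.law D lam mu T k (x k)) →
          L.IsTrajectory r T y (fun k => L.law D lam mu T k (y k)) →
          ‖x t - y t‖ ≤ C * α ^ (t - r) * ‖x r - y r‖) ∧
      -- time-invariant data: the limiting stationary law and its closed loop
      (∀ (s : ℕ) (D : AffineData n m s ι) (lam : ℕ → ι → ℝ) (mu : ℕ → Fin s → ℝ),
        (∀ t, D.c t = D.c 0) → (∀ t, D.G t = D.G 0) →
        (∀ t, lam t = lam 0) → (∀ t, mu t = mu 0) →
        (∀ i, 0 ≤ lam 0 i ∧ lam 0 i ≤ Λ) → (∀ j, 0 ≤ mu 0 j) →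
        ∃ (Kinf : Matrix (Fin m) (Fin n) ℝ) (linf : Fin m → ℝ) (xbar : Fin n → ℝ),
          (∀ t, Tendsto (fun T => L.K (L.F lam T (t + 1))) atTop (𝓝 Kinf)) ∧
          (∀ t, Tendsto (fun T => L.offset D lam mu T t) atTop (𝓝 linf)) ∧
          SchurStable (L.A - L.B * Kinf) ∧
          xbar = L.A *ᵥ xbar + L.B *ᵥ (-(Kinf *ᵥ xbar) + linf) ∧
          ∀ x : ℕ → Fin n → ℝ,
            (∀ t, x (t + 1) = L.A *ᵥ x t + L.B *ᵥ (-(Kinf *ᵥ x t) + linf)) →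
            ∀ t, ‖x t - xbar‖ ≤ C * α ^ t * ‖x 0 - xbar‖)) := by
  obtain ⟨hdet, hopt, hstab⟩ := theorem2_general L hL
  refine ⟨hdet, fun s D T lam mu hlam _ => hopt s D T lam mu hlam, fun Λ => ?_⟩
  obtain ⟨C, α, hC, hα0, hα1, hdecay, hlim⟩ := hstab Λ
  exact ⟨C, α, hC, hα0, hα1, fun s D T lam mu hlam _ => hdecay s D T lam mu hlam,
    fun s D lam mu hc hG hlam hmu hΛ _ => hlim s D lam mu hc hG hlam hmu hΛ⟩
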